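/- **Notation.** Let $\tau\in\mathbb C$ with $\operatorname{Im}\tau>0$, $z\in\mathbb C$, and $q^x=e^{2\pi i\tau x}$ for $x\in\mathbb Q$. For rational $k$ and rational $m>0$ put $$\theta^{(\pm)}_{k,m}(\tau,z)=\sum_{j\in\mathbb Z}(\pm1)^j q^{m(j+\frac{k}{2m})^2}e^{2\pi i m(j+\frac{k}{2m})z},\qquad \theta_{k,m}=\theta^{(+)}_{k,m},$$ and let $\eta(\tau)=q^{1/24}\prod_{n\ge1}(1-q^n)$. For $m\in\mathbb N=\{1,2,\dots\}$ and $s\in\mathbb Z$ put $$\Phi_1^{[m,s]}(\tau,z_1,z_2,t)=e^{-2\pi imt}\sum_{j\in\mathbb Z}\frac{e^{2\pi imj(z_1+z_2)+2\pi isz_1}q^{mj^2+sj}}{1-e^{2\pi iz_1}q^j},\qquad \Phi_2^{[m,s]}(\tau,z_1,z_2,t)=e^{-2\pi imt}\sum_{j\in\mathbb Z}\frac{e^{-2\pi imj(z_1+z_2)-2\pi isz_2}q^{mj^2+sj}}{1-e^{-2\pi iz_2}q^j},$$ $\Phi^{[m,s]*}=\Phi_1^{[m,s]}+\Phi_2^{[m,s]}$.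 With $E(x)=2\int_0^xe^{-\pi u^2}du$ and $$R_{j,m}(\tau,v)=\sum_{n\equiv j\ (2m)}\Big\{\operatorname{sgn}\big(n-\tfrac12-j+2m\big)-E\Big(\big(n-2m\tfrac{\operatorname{Im}v}{\operatorname{Im}\tau}\big)\sqrt{\tfrac{\operatorname{Im}\tau}{m}}\Big)\Big\}e^{-\frac{\pi in^2\tau}{2m}+2\pi inv},$$ put $$\Phi^{[m,s]*}_{\rm add}(\tau,z_1,z_2,t)=-\tfrac12e^{-2\pi imt}\sum_{s\le j<s+2m}R_{j,m}\big(\tau,\tfrac{z_1-z_2}2\big)\big[\theta_{j,m}+\theta_{-j,m}\big](\tau,z_1+z_2),\qquad \widetilde\Phi^{[m,s]*}=\Phi^{[m,s]*}+\Phi^{[m,s]*}_{\rm add}.$$ Write $\frac12\mathbb Z_{\rm odd}=\frac12+\mathbb Z$. For $\epsilon\in\{1,-1\}$ put $$A_\epsilon=\Big[\sum_{\substack{j,r\in\frac12\mathbb Z_{\rm odd}\\0\le r<j}}-\sum_{\substack{j,r\in\frac12\mathbb Z_{\rm odd}\\j\le r<0}}\Big]\sum_{0<k<m}(-1)^{j-\frac12}\epsilon^k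 q^{(m+\frac12)(j+\frac{2pm}{2m+1})^2}q^{-\frac1{4m}(2mr+k+2mp)^2}\big[\theta_{k,m}+\theta_{-k,m}\big](\tau,z),$$ $$B_\epsilon=\Big[\sum_{\substack{j,r\in\frac12\mathbb Z_{\rm odd}\\0\le r\le j}}-\sum_{\substack{j,r\in\frac12\mathbb Z_{\rm odd}\\j<r<0}}\Big]\sum_{0\le k\le m}(-1)^{j-\frac12}\epsilon^k q^{(m+\frac12)(j+\frac{2pm}{2m+1})^2}q^{-\frac1{4m}(2mr-k+2mp)^2}\big[\theta_{k,m}+\theta_{-k,m}\big](\tau,z).$$ **Proposition.** Let $m\in\mathbb N$ and let $p\ge0$ be an integer. The double series in $A_{\pm1}$, $B_{\pm1}$ (over each of their index regions) converge absolutely, and: 1) if $\frac z2+\frac\tau2-\frac12\notin\mathbb Z+\mathbb Z\tau$, then $$\begin{aligned} &(-1)^pq^{-\frac m4}\theta^{(-)}_{p-m-\frac12,m+\frac12}(\tau,0)\,\widetilde\Phi^{[m,0]*}\Big(\tau,\frac z2+\frac\tau2-\frac12,\frac z2-\frac\tau2+\frac12,0\Big)\\ &=\frac{\eta(\tau)^3}{\theta_{0,\frac12}(\tau,z)}\big[\theta_{p,m+\frac12}+\theta_{-p,m+\frac12}\big](\tau,z)-A_{-1}-B_{-1}\\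 &\quad-(-1)^p\theta^{(-)}_{p-m-\frac12,m+\frac12}(\tau,0)\sum_{-p<r\le p}\ \sum_{0\le k<m}(-1)^kq^{-\frac1{4m}(m(2r-1)+k)^2}\big[\theta_{k,m}+\theta_{-k,m}\big](\tau,z)\\ &\quad+2(-1)^p\theta^{(-)}_{p-m-\frac12,m+\frac12}(\tau,0)\sum_{0\le r\le p-1}q^{-m(r+\frac12)^2}\theta_{0,m}(\tau,z)\\ &\quad-(-1)^{m+p}\theta^{(-)}_{p-m-\frac12,m+\frac12}(\tau,0)\sum_{-p<r<p}q^{-mr^2}\theta_{m,m}(\tau,z); \end{aligned}$$ 2) if $\frac z2+\frac\tau2\notin\mathbb Z+\mathbb Z\tau$, then $$\begin{aligned} &(-1)^pq^{-\frac m4}\theta^{(-)}_{-p+m+\frac12,m+\frac12}(\tau,0)\,\widetilde\Phi^{[m,0]*}\Big(\tau,\frac z2+\frac\tau2,\frac z2-\frac\tau2,0\Big)\\ &=(-1)^p\frac{\eta(\tau)^3}{\theta^{(-)}_{0,\frac12}(\tau,z)}\big[\theta^{(-)}_{p,m+\frac12}+\theta^{(-)}_{-p,m+\frac12}\big](\tau,z)-A_1-B_1\\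 &\quad-\theta^{(-)}_{2mp+m+\frac12,m+\frac12}(\tau,0)\sum_{-p<r\le p}\ \sum_{0\le k<m}q^{-\frac1{4m}(m(2r-1)+k)^2}\big[\theta_{k,m}+\theta_{-k,m}\big](\tau,z)\\ &\quad+2\,\theta^{(-)}_{2mp+m+\frac12,m+\frac12}(\tau,0)\sum_{0\le r\le p-1}q^{-m(r+\frac12)^2}\theta_{0,m}(\tau,z)\\ &\quad-\theta^{(-)}_{2mp+m+\frac12,m+\frac12}(\tau,0)\sum_{-p<r<p}q^{-mr^2}\theta_{m,m}(\tau,z). \end{aligned}$$ Here $r$ and $k$ in the finite sums run over integers. -/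

import Mathlib

namespace Wakimoto

noncomputable section

/-- `q ^ x = exp (2 π i τ x)`, for a rational exponent `x`. -/
def qpow (τ : ℂ) (x : ℚ) : ℂ :=
  Complex.exp (2 * Real.pi * Complex.I * τ * (x : ℂ))

/-- The theta function `θ_{k,m}(τ,z) = ∑_{j ∈ ℤ} q^{m (j + k/2m)²} e^{2πi m (j + k/2m) z}`. -/
def theta (k m : ℚ) (τ z : ℂ) : ℂ :=
  ∑' j : ℤ, qpow τ (m * ((j : ℚ) + k / (2 * m)) ^ 2) *
    Complex.exp (2 * Real.pi * Complex.I * ((m * ((j : ℚ) + k / (2 * m)) : ℚ) : ℂ) * z)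

/-- The signed theta function
`θ^{(-)}_{k,m}(τ,z) = ∑_{j ∈ ℤ} (-1)^j q^{m (j + k/2m)²} e^{2πi m (j + k/2m) z}`. -/
def thetaMinus (k m : ℚ) (τ z : ℂ) : ℂ :=
  ∑' j : ℤ, (-1 : ℂ) ^ j * qpow τ (m * ((j : ℚ) + k / (2 * m)) ^ 2) *
    Complex.exp (2 * Real.pi * Complex.I * ((m * ((j : ℚ) + k / (2 * m)) : ℚ) : ℂ) * z)

/-- The mock theta function
`Φ_1^{[m,s]}(τ,z₁,z₂,t) = e^{-2πimt} ∑_j e^{2πimj(z₁+z₂)+2πisz₁} q^{mj²+sj} / (1 - e^{2πiz₁} q^j)`. -/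
def Phi1 (m : ℕ) (s : ℤ) (τ z₁ z₂ t : ℂ) : ℂ :=
  Complex.exp (-2 * Real.pi * Complex.I * m * t) *
    ∑' j : ℤ,
      Complex.exp (2 * Real.pi * Complex.I * m * j * (z₁ + z₂)
          + 2 * Real.pi * Complex.I * s * z₁) *
        qpow τ ((m : ℚ) * (j : ℚ) ^ 2 + (s : ℚ) * (j : ℚ)) /
          (1 - Complex.exp (2 * Real.pi * Complex.I * z₁) * qpow τ (j : ℚ))

/-- The mock theta function
`Φ_2^{[m,s]}(τ,z₁,z₂,t) =
  e^{-2πimt} ∑_j e^{-2πimj(z₁+z₂)-2πisz₂} q^{mj²+sj} / (1 - e^{-2πiz₂} q^j)`. -/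
def Phi2 (m : ℕ) (s : ℤ) (τ z₁ z₂ t : ℂ) : ℂ :=
  Complex.exp (-2 * Real.pi * Complex.I * m * t) *
    ∑' j : ℤ,
      Complex.exp (-2 * Real.pi * Complex.I * m * j * (z₁ + z₂)
          - 2 * Real.pi * Complex.I * s * z₂) *
        qpow τ ((m : ℚ) * (j : ℚ) ^ 2 + (s : ℚ) * (j : ℚ)) /
          (1 - Complex.exp (-2 * Real.pi * Complex.I * z₂) * qpow τ (j : ℚ))

/-- `Φ^{[m,s]*} = Φ_1^{[m,s]} + Φ_2^{[m,s]}`. -/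
def PhiStar (m : ℕ) (s : ℤ) (τ z₁ z₂ t : ℂ) : ℂ :=
  Phi1 m s τ z₁ z₂ t + Phi2 m s τ z₁ z₂ t

/-- Zwegers' error function `E(x) = 2 ∫_0^x e^{-π u²} du`. -/
def zwegersE (x : ℝ) : ℝ :=
  2 * ∫ u in (0 : ℝ)..x, Real.exp (-Real.pi * u ^ 2)

/-- Zwegers' non-holomorphic function
`R_{j,m}(τ,v) = ∑_{n ≡ j mod 2m}
  (sgn(n - 1/2 - j + 2m) - E((n - 2m Im v / Im τ) √(Im τ / m))) e^{-πin²τ/(2m) + 2πinv}`;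
the sum runs over `n = j + 2ml` with `l ∈ ℤ`. -/
def zwegersR (j : ℤ) (m : ℕ) (τ v : ℂ) : ℂ :=
  ∑' l : ℤ,
    ((Real.sign (((j + 2 * m * l : ℤ) : ℝ) - 1 / 2 - j + 2 * m)
        - zwegersE ((((j + 2 * m * l : ℤ) : ℝ) - 2 * m * v.im / τ.im) * √(τ.im / m)) : ℝ) : ℂ) *
      Complex.exp (-Real.pi * Complex.I * ((j + 2 * m * l : ℤ) : ℂ) ^ 2 * τ / (2 * m)
        + 2 * Real.pi * Complex.I * ((j + 2 * m * l : ℤ) : ℂ) * v)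

/-- The correction function of `Φ_1^{[m,s]}`. -/
def Phi1Add (m : ℕ) (s : ℤ) (τ z₁ z₂ t : ℂ) : ℂ :=
  -(1 / 2) * Complex.exp (-2 * Real.pi * Complex.I * m * t) *
    ∑ j ∈ Finset.Ico s (s + 2 * m),
      zwegersR j m τ ((z₁ - z₂) / 2) * theta (j : ℚ) (m : ℚ) τ (z₁ + z₂)

/-- The correction function of `Φ_2^{[m,s]}`. -/
def Phi2Add (m : ℕ) (s : ℤ) (τ z₁ z₂ t : ℂ) : ℂ :=
  -(1 / 2) * Complex.exp (-2 * Real.pi * Complex.I * m * t) *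
    ∑ j ∈ Finset.Ico s (s + 2 * m),
      zwegersR j m τ ((z₁ - z₂) / 2) * theta (-(j : ℚ)) (m : ℚ) τ (z₁ + z₂)

/-- `Φ^{[m,s]*}_add = Φ^{[m,s]}_{1,add} + Φ^{[m,s]}_{2,add}`. -/
def PhiStarAdd (m : ℕ) (s : ℤ) (τ z₁ z₂ t : ℂ) : ℂ :=
  Phi1Add m s τ z₁ z₂ t + Phi2Add m s τ z₁ z₂ t

/-- Zwegers' modified function `Φ̃^{[m,s]*} = Φ^{[m,s]*} + Φ^{[m,s]*}_add`. -/
def PhiStarTilde (m : ℕ) (s : ℤ) (τ z₁ z₂ t : ℂ) : ℂ :=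
  PhiStar m s τ z₁ z₂ t + PhiStarAdd m s τ z₁ z₂ t

/-- The element `a + 1/2` of `½ ℤ_odd`; pairs `(j, r)` of such numbers are indexed by
pairs of integers `x`, through `j = halfOdd x.1`, `r = halfOdd x.2`. -/
def halfOdd (a : ℤ) : ℚ := (a : ℚ) + 1 / 2

/-- `0 ≤ r < j`. -/
def conePosLt : Set (ℤ × ℤ) := {x | 0 ≤ halfOdd x.2 ∧ halfOdd x.2 < halfOdd x.1}

/-- `j ≤ r < 0`. -/
def coneNegLe : Set (ℤ × ℤ) := {x | halfOdd x.1 ≤ halfOdd x.2 ∧ halfOdd x.2 < 0}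

/-- `0 ≤ r ≤ j`. -/
def conePosLe : Set (ℤ × ℤ) := {x | 0 ≤ halfOdd x.2 ∧ halfOdd x.2 ≤ halfOdd x.1}

/-- `j < r < 0`. -/
def coneNegLt : Set (ℤ × ℤ) := {x | halfOdd x.1 < halfOdd x.2 ∧ halfOdd x.2 < 0}

/-- `∑_{0<k<m} (-1)^{j-1/2} c^k q^{(m+1/2)(j+2pm/(2m+1))²} q^{-(2mr+k+2mp)²/(4m)}
[θ_{k,m}+θ_{-k,m}](τ,z)`, where `c` is `-1` or `1`. -/
def termA (c : ℂ) (m p : ℕ) (τ z : ℂ) (x : ℤ × ℤ) : ℂ :=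
  ∑ k ∈ Finset.Ioo (0 : ℤ) m,
    (-1 : ℂ) ^ x.1 * c ^ k
      * qpow τ (((m : ℚ) + 1 / 2) * (halfOdd x.1 + 2 * p * m / (2 * m + 1)) ^ 2)
      * qpow τ (-(2 * m * halfOdd x.2 + k + 2 * m * p) ^ 2 / (4 * m))
      * (theta (k : ℚ) m τ z + theta (-(k : ℚ)) m τ z)

/-- `∑_{0≤k≤m} (-1)^{j-1/2} c^k q^{(m+1/2)(j+2pm/(2m+1))²} q^{-(2mr-k+2mp)²/(4m)}
[θ_{k,m}+θ_{-k,m}](τ,z)`, where `c` is `-1` or `1`. -/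
def termB (c : ℂ) (m p : ℕ) (τ z : ℂ) (x : ℤ × ℤ) : ℂ :=
  ∑ k ∈ Finset.Icc (0 : ℤ) m,
    (-1 : ℂ) ^ x.1 * c ^ k
      * qpow τ (((m : ℚ) + 1 / 2) * (halfOdd x.1 + 2 * p * m / (2 * m + 1)) ^ 2)
      * qpow τ (-(2 * m * halfOdd x.2 - k + 2 * m * p) ^ 2 / (4 * m))
      * (theta (k : ℚ) m τ z + theta (-(k : ℚ)) m τ z)

end

end Wakimoto

namespace Wakimoto

/-! Put W = c·e^{πiz} with c = -1 in part 1 and c = 1 in part 2; then both parts are the single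
identity `main_identity`.

The starting point is the partial fraction expansion of η³/θ (`recipSeries_mul_thetaOdd`), the limit
of a finite expansion obtained from Lagrange interpolation and the finite triple product. Multiply
this expansion by the theta series `thetaP`, and compare with the Appell sum `appell` times the
theta constant S = ∑ `shiftCoeff`. In suitable coordinates (n, J) both products are double series
with the same coefficients `pairCoeff`, one against u^(upperEnd)/(1-u) and the other against
u^(2mn)/(1-u), where u = W q^{n+1/2}. Their difference is a signed finite geometric sum, so the
poles cancel (`recipSeries_mul_thetaP`).

Now collect powers of W. The exponents 2mb+k with k fixed produce θ_{k,m} times an indefinite double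
series `coneSum`, cut by a row and by an antidiagonal. Only the antidiagonal cut depends on b, and
moving it changes nothing because each antidiagonal sums to zero under a sign-reversing reflection
(`coneSum_diag`). Moving the row cut by one step costs S times one `rowCoeff`
(`coneSum_add_one_row`). Taking the row cut to p gives A and B, and the rows crossed give the finite
sums.

Adding the identities at W and W⁻¹ turns the Appell sums into Φ*. At the relevant argument of R the
error functions cancel between j and 2m-j, since E is odd, and Φ_add becomes a finite combination of
the `rowCoeff` in row 0 (`PhiStarAdd_eq`). It absorbs the row-0 terms for 0 ≤ k < m and half of the
one for k = m. -/

/-! ### The q-binomial theorem and the finite triple product -/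

/-- The finite `q`-Pochhammer symbol `(q; q)_n`. -/
noncomputable def qPoch (q : ℂ) (n : ℕ) : ℂ := ∏ i ∈ Finset.range n, (1 - q ^ (i + 1))

theorem qPoch_succ (q : ℂ) (n : ℕ) : qPoch q (n + 1) = qPoch q n * (1 - q ^ (n + 1)) :=
  Finset.prod_range_succ _ _

theorem qPoch_zero (q : ℂ) : qPoch q 0 = 1 := rfl

theorem one_sub_pow_ne_zero {q : ℂ} (hq : ‖q‖ < 1) (n : ℕ) : 1 - q ^ (n + 1) ≠ 0 := by
  intro h
  have h1 : ‖q ^ (n + 1)‖ = 1 := by rw [← sub_eq_zero.mp h]; simp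
  rw [norm_pow] at h1
  exact absurd h1 (pow_lt_one₀ (norm_nonneg _) hq (by omega)).ne

theorem qPoch_ne_zero {q : ℂ} (hq : ‖q‖ < 1) (n : ℕ) : qPoch q n ≠ 0 :=
  Finset.prod_ne_zero_iff.mpr fun i _ => one_sub_pow_ne_zero hq i

/-- The `q`-binomial theorem, with `q = s ^ 2`. -/
theorem prod_one_sub_mul_odd_pow {s : ℂ} (hs : ‖s ^ 2‖ < 1) (y : ℂ) (n : ℕ) :
    ∏ k ∈ Finset.range n, (1 - y * s ^ (2 * k + 1)) =
      ∑ i ∈ Finset.range (n + 1), (-1) ^ i * s ^ (i * i) * y ^ i *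
        (qPoch (s ^ 2) n / (qPoch (s ^ 2) i * qPoch (s ^ 2) (n - i))) := by
  induction n with
  | zero => simp [qPoch_zero]
  | succ n ih =>
    have hne := qPoch_ne_zero hs
    rw [Finset.prod_range_succ, mul_sub, mul_one]
    conv_lhs => arg 1; rw [ih, Finset.sum_range_succ']
    conv_lhs => arg 2; rw [ih, Finset.sum_range_succ, add_mul, Finset.sum_mul]
    rw [Finset.sum_range_succ' _ (n + 1), Finset.sum_range_succ _ n]
    -- This is the q-Pascal recursion for the coefficients.
    have key : ∀ i ∈ Finset.range n,
        (-1 : ℂ) ^ (i + 1) * s ^ ((i + 1) * (i + 1)) * y ^ (i + 1) *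
          (qPoch (s ^ 2) (n + 1) / (qPoch (s ^ 2) (i + 1) * qPoch (s ^ 2) (n + 1 - (i + 1)))) =
        (-1 : ℂ) ^ (i + 1) * s ^ ((i + 1) * (i + 1)) * y ^ (i + 1) *
          (qPoch (s ^ 2) n / (qPoch (s ^ 2) (i + 1) * qPoch (s ^ 2) (n - (i + 1)))) -
        (-1) ^ i * s ^ (i * i) * y ^ i *
          (qPoch (s ^ 2) n / (qPoch (s ^ 2) i * qPoch (s ^ 2) (n - i))) *
          (y * s ^ (2 * n + 1)) := by
      intro i hi
      obtain ⟨d, rfl⟩ : ∃ d, n = i + 1 + d :=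
        ⟨n - (i + 1), by have := Finset.mem_range.mp hi; omega⟩
      rw [show i + 1 + d + 1 - (i + 1) = d + 1 by omega, show i + 1 + d - (i + 1) = d by omega,
        show i + 1 + d - i = d + 1 by omega, qPoch_succ _ (i + 1 + d), qPoch_succ _ d,
        qPoch_succ _ i]
      have h1 := hne i
      have h2 := hne d
      have h3 := one_sub_pow_ne_zero hs i
      have h4 := one_sub_pow_ne_zero hs d
      field_simp
      ring
    rw [Finset.sum_congr rfl key, Finset.sum_sub_distrib]
    have h1 : ∀ n, qPoch (s ^ 2) n / (qPoch (s ^ 2) n * 1) = 1 := fun n => by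
      rw [mul_one, div_self (hne n)]
    have h2 : ∀ n, qPoch (s ^ 2) n / (1 * qPoch (s ^ 2) n) = 1 := fun n => by
      rw [one_mul, div_self (hne n)]
    simp only [Nat.sub_self, Nat.sub_zero, qPoch_zero, h1, h2]
    ring

/-- Pulling -w s^{-(2k+1)} out of each factor with negative exponent turns it into a factor in w⁻¹;
the extracted odd powers multiply to s^{-N²}. -/
theorem prod_odd_zpow {s w : ℂ} (hs0 : s ≠ 0) (hw : w ≠ 0) (N : ℕ) :
    ∏ k ∈ Finset.range (2 * N), (1 - w * s ^ (2 * ((k : ℤ) - N) + 1)) =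
      (-w) ^ N * (s ^ (N * N))⁻¹ *
        ∏ k ∈ Finset.range N, ((1 - w * s ^ (2 * k + 1)) * (1 - w⁻¹ * s ^ (2 * k + 1))) := by
  rw [two_mul, Finset.prod_range_add, Finset.prod_mul_distrib, ← Finset.prod_range_reflect]
  have h1 : ∀ k ∈ Finset.range N, (1 - w * s ^ (2 * (((N - 1 - k : ℕ) : ℤ) - N) + 1)) =
      (-w * (s ^ (2 * k + 1))⁻¹) * (1 - w⁻¹ * s ^ (2 * k + 1)) := by
    intro k hk
    have hk := Finset.mem_range.mp hk
    have : (2 * (((N - 1 - k : ℕ) : ℤ) - N) + 1) = -((2 * k + 1 : ℕ) : ℤ) := by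
      push_cast [show k ≤ N - 1 by omega, show 1 ≤ N by omega]; ring
    rw [this, zpow_neg, zpow_natCast]
    field_simp
    ring
  have h2 : ∀ k ∈ Finset.range N, (1 - w * s ^ (2 * (((N + k : ℕ) : ℤ) - N) + 1)) =
      1 - w * s ^ (2 * k + 1) := by
    intro k _
    rw [show (2 * (((N + k : ℕ) : ℤ) - N) + 1) = ((2 * k + 1 : ℕ) : ℤ) by push_cast; ring,
      zpow_natCast]
  have h3 : ∏ k ∈ Finset.range N, (-w * (s ^ (2 * k + 1))⁻¹) = (-w) ^ N * (s ^ (N * N))⁻¹ := by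
    rw [Finset.prod_mul_distrib, Finset.prod_const, Finset.card_range, Finset.prod_inv_distrib,
      Finset.prod_pow_eq_pow_sum]
    congr 3
    clear h1 h2
    induction N with
    | zero => rfl
    | succ n ih => rw [Finset.sum_range_succ, ih]; ring
  rw [Finset.prod_congr rfl h1, Finset.prod_congr rfl h2, Finset.prod_mul_distrib, h3]
  ring

/-- The finite Jacobi triple product. -/
theorem finite_triple_product {s w : ℂ} (hs0 : s ≠ 0) (hs : ‖s ^ 2‖ < 1) (hw : w ≠ 0) (N : ℕ) :
    ∏ k ∈ Finset.range N, ((1 - w * s ^ (2 * k + 1)) * (1 - w⁻¹ * s ^ (2 * k + 1))) =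
      ∑ j ∈ Finset.Icc (-N : ℤ) N, (-1) ^ j * s ^ (j * j) * w ^ j *
        (qPoch (s ^ 2) (2 * N) /
          (qPoch (s ^ 2) (N + j).toNat * qPoch (s ^ 2) (N - j).toNat)) := by
  have h1 := prod_odd_zpow hs0 hw N
  -- Taking y = w s^{-2N} centres the 2N exponents around zero.
  have h2 := prod_one_sub_mul_odd_pow hs (w * s ^ (-(2 * N : ℤ))) (2 * N)
  have h3 : ∏ k ∈ Finset.range (2 * N), (1 - w * s ^ (2 * ((k : ℤ) - N) + 1)) =
      ∏ k ∈ Finset.range (2 * N), (1 - w * s ^ (-(2 * N : ℤ)) * s ^ (2 * k + 1)) := by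
    refine Finset.prod_congr rfl fun k _ => ?_
    rw [mul_assoc, ← zpow_natCast, ← zpow_add₀ hs0]
    congr 3; push_cast; ring
  rw [h3, h2] at h1
  have h4 : (-w) ^ N * (s ^ (N * N))⁻¹ ≠ 0 :=
    mul_ne_zero (pow_ne_zero _ (neg_ne_zero.mpr hw)) (inv_ne_zero (pow_ne_zero _ hs0))
  apply mul_left_cancel₀ h4
  rw [← h1, Finset.mul_sum]
  refine Finset.sum_nbij' (fun i => (i : ℤ) - N) (fun j => (j + N).toNat) ?_ ?_ ?_ ?_ ?_
  · intro i hi; simp at hi ⊢; omega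
  · intro i hi; simp at hi ⊢; omega
  · intro i hi; simp
  · intro i hi; simp at hi ⊢; omega
  · intro i hi
    have hi := Finset.mem_range.mp hi
    rw [show ((N : ℤ) + ((i : ℤ) - N)).toNat = i by omega,
      show ((N : ℤ) - ((i : ℤ) - N)).toNat = 2 * N - i by omega]
    rw [← mul_assoc]
    congr 1
    have e1 : (w * s ^ (-(2 * N : ℤ))) ^ i = w ^ (i : ℤ) * s ^ (-(2 * N : ℤ) * i) := by
      rw [mul_pow, zpow_natCast, zpow_mul, zpow_natCast]
    have e2 : (-w) ^ N = (-1) ^ (N : ℤ) * w ^ (N : ℤ) := by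
      rw [neg_pow, zpow_natCast, zpow_natCast]
    have e3 : (s ^ (N * N))⁻¹ = s ^ (-((N * N : ℕ) : ℤ)) := by rw [zpow_neg, zpow_natCast]
    rw [e1, e2, e3, zpow_sub₀ (by norm_num : (-1 : ℂ) ≠ 0), zpow_sub₀ hw, ← zpow_natCast,
      ← zpow_natCast]
    have e : s ^ ((i * i : ℕ) : ℤ) * s ^ (-(2 * N : ℤ) * (i : ℤ)) =
        s ^ (-((N * N : ℕ) : ℤ)) * s ^ (((i : ℤ) - N) * ((i : ℤ) - N)) := by
      rw [← zpow_add₀ hs0, ← zpow_add₀ hs0]; congr 1; push_cast; ring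
    have h5 : (-1 : ℂ) ^ (N : ℤ) ≠ 0 := zpow_ne_zero _ (by norm_num)
    have h6 : w ^ (N : ℤ) ≠ 0 := zpow_ne_zero _ hw
    calc _ = (-1 : ℂ) ^ (i : ℤ) * w ^ (i : ℤ) *
          (s ^ ((i * i : ℕ) : ℤ) * s ^ (-(2 * N : ℤ) * (i : ℤ))) := by ring
      _ = _ := by rw [e]; field_simp

/-! ### Finite partial fractions by Lagrange interpolation -/

theorem prod_range_erase {M : Type*} [CommMonoid M] (f : ℕ → M) {n i : ℕ} (hi : i < n) :
    ∏ j ∈ (Finset.range n).erase i, f j =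
      (∏ j ∈ Finset.range i, f (i - 1 - j)) * ∏ j ∈ Finset.range (n - 1 - i), f (i + 1 + j) := by
  obtain ⟨d, rfl⟩ : ∃ d, n = i + 1 + d := ⟨n - (i + 1), by omega⟩
  rw [Finset.prod_range_reflect, show i + 1 + d - 1 - i = d by omega]
  have : (Finset.range (i + 1 + d)).erase i =
      Finset.range i ∪ (Finset.range d).map (addLeftEmbedding (i + 1)) := by
    ext j
    simp only [Finset.mem_erase, Finset.mem_range, Finset.mem_union, Finset.mem_map,
      addLeftEmbedding_apply]
    constructor
    · rintro ⟨h1, h2⟩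
      rcases lt_or_gt_of_ne h1 with h | h
      · exact Or.inl h
      · exact Or.inr ⟨j - (i + 1), by omega, by omega⟩
    · rintro (h | ⟨a, h1, h2⟩) <;> omega
  rw [this, Finset.prod_union, Finset.prod_map]
  · rfl
  · rw [Finset.disjoint_left]
    intro a ha
    simp only [Finset.mem_range, Finset.mem_map, addLeftEmbedding_apply, not_exists, not_and] at ha ⊢
    intro b _; omega

theorem prod_erase_one_sub_zpow {q : ℂ} (hq0 : q ≠ 0) {n i : ℕ} (hi : i < n) :
    ∏ j ∈ (Finset.range n).erase i, (1 - q ^ ((j : ℤ) - i)) =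
      (-1) ^ i * (∏ j ∈ Finset.range i, (q ^ (j + 1))⁻¹) * qPoch q i * qPoch q (n - 1 - i) := by
  rw [prod_range_erase _ hi]
  have h1 : ∀ j ∈ Finset.range i, (1 - q ^ (((i - 1 - j : ℕ) : ℤ) - i)) =
      (-1) * (q ^ (j + 1))⁻¹ * (1 - q ^ (j + 1)) := by
    intro j hj
    have hj := Finset.mem_range.mp hj
    rw [show ((i - 1 - j : ℕ) : ℤ) - i = -((j + 1 : ℕ) : ℤ) by omega, zpow_neg, zpow_natCast]
    field_simp
    ring
  have h2 : ∀ j ∈ Finset.range (n - 1 - i), (1 - q ^ (((i + 1 + j : ℕ) : ℤ) - i)) =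
      (1 - q ^ (j + 1)) := by
    intro j _
    rw [show ((i + 1 + j : ℕ) : ℤ) - i = ((j + 1 : ℕ) : ℤ) by omega, zpow_natCast]
  rw [Finset.prod_congr rfl h1, Finset.prod_congr rfl h2, Finset.prod_mul_distrib,
    Finset.prod_mul_distrib, Finset.prod_const, Finset.card_range]
  rfl

/-- X^N has degree below the number of nodes, so it equals its interpolation polynomial; dividing by
the nodal polynomial gives the partial fractions. -/
theorem lagrange_one_div {x : ℂ} {n N : ℕ} {v : ℕ → ℂ} (hN : N < n)
    (hv : Set.InjOn v (Finset.range n)) (hx : ∀ i ∈ Finset.range n, x ≠ v i)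
    (hv0 : ∀ i ∈ Finset.range n, v i ≠ 0) :
    x ^ N = (∏ i ∈ Finset.range n, (1 - x / v i)) *
      ∑ i ∈ Finset.range n, v i ^ N /
        ((∏ j ∈ (Finset.range n).erase i, (1 - v i / v j)) * (1 - x / v i)) := by
  have h1 : (Polynomial.X ^ N : Polynomial ℂ) =
      Lagrange.interpolate (Finset.range n) v fun i => (Polynomial.X ^ N : Polynomial ℂ).eval (v i) := by
    apply Lagrange.eq_interpolate hv
    rw [Polynomial.degree_X_pow, Finset.card_range]
    exact_mod_cast hN
  have h2 := congrArg (Polynomial.eval x) h1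
  rw [Lagrange.eval_interpolate_not_at_node _ hx, Lagrange.eval_nodal] at h2
  simp only [Polynomial.eval_pow, Polynomial.eval_X] at h2
  rw [h2, Finset.mul_sum, Finset.mul_sum]
  refine Finset.sum_congr rfl fun i hi => ?_
  have e1 : ∏ i ∈ Finset.range n, (x - v i) =
      (∏ i ∈ Finset.range n, (-v i)) * ∏ i ∈ Finset.range n, (1 - x / v i) := by
    rw [← Finset.prod_mul_distrib]
    refine Finset.prod_congr rfl fun j hj => ?_
    have := hv0 j hj
    field_simp; ring
  have e2 : ∏ j ∈ (Finset.range n).erase i, (v i - v j) =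
      (∏ j ∈ (Finset.range n).erase i, (-v j)) *
        ∏ j ∈ (Finset.range n).erase i, (1 - v i / v j) := by
    rw [← Finset.prod_mul_distrib]
    refine Finset.prod_congr rfl fun j hj => ?_
    have := hv0 j (Finset.mem_of_mem_erase hj)
    field_simp; ring
  rw [Lagrange.nodalWeight, Finset.prod_inv_distrib, e1, e2, ← Finset.mul_prod_erase _ (fun i => -v i) hi]
  have h3 : ∏ j ∈ (Finset.range n).erase i, (-v j) ≠ 0 :=
    Finset.prod_ne_zero_iff.mpr fun j hj => neg_ne_zero.mpr (hv0 j (Finset.mem_of_mem_erase hj))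
  have h4 : v i ≠ 0 := hv0 i hi
  have h5 : x - v i ≠ 0 := sub_ne_zero.mpr (hx i hi)
  have h6 : 1 - x / v i = -(x - v i) / v i := by field_simp; ring
  rw [h6]
  field_simp

theorem zpow_injective_of_norm_lt_one {q : ℂ} (hq0 : q ≠ 0) (hq : ‖q‖ < 1) :
    Function.Injective fun n : ℤ => q ^ n := by
  intro a b hab
  have h : ‖q‖ ^ a = ‖q‖ ^ b := by simpa using congrArg norm hab
  exact zpow_right_injective₀ (norm_pos_iff.mpr hq0) hq.ne h

/-- The partial fraction decomposition of the finite triple product. -/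
theorem finite_partial_fraction {s w : ℂ} (hs0 : s ≠ 0) (hs : ‖s ^ 2‖ < 1) (hw : w ≠ 0)
    (hws : ∀ n : ℤ, 1 - w * s ^ (2 * n + 1) ≠ 0) {N : ℕ} (hN : 0 < N) :
    (∏ k ∈ Finset.range N, ((1 - w * s ^ (2 * k + 1)) * (1 - w⁻¹ * s ^ (2 * k + 1)))) *
      ∑ k ∈ Finset.Ico (-N : ℤ) N, (-1) ^ k * s ^ (k * (k + 1)) / (1 - w * s ^ (2 * k + 1)) /
        (qPoch (s ^ 2) (N + k).toNat * qPoch (s ^ 2) (N - 1 - k).toNat) = 1 := by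
  set v : ℕ → ℂ := fun i => s ^ (-(2 * ((i : ℤ) - N) + 1)) with hv
  have hq0 : s ^ 2 ≠ 0 := pow_ne_zero _ hs0
  have hdiv : ∀ (x : ℂ) i, x / v i = x * s ^ (2 * ((i : ℤ) - N) + 1) := by
    intro x i
    rw [hv, div_eq_mul_inv, ← zpow_neg, neg_neg]
  have hvv : ∀ i j, v i / v j = (s ^ 2) ^ ((j : ℤ) - i) := by
    intro i j
    rw [hdiv, hv, ← zpow_natCast s 2, ← zpow_mul, ← zpow_add₀ hs0]
    congr 1; push_cast; ring
  have hv0 : ∀ i, v i ≠ 0 := fun i => zpow_ne_zero _ hs0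
  -- The nodes are the zeros of the 2N factors in `prod_odd_zpow`. The monomial X^N is chosen
  -- because w^N cancels the prefactor (-w)^N there.
  have h1 := lagrange_one_div (x := w) (n := 2 * N) (N := N) (v := v) (by omega) ?_ ?_
    (fun i _ => hv0 i)
  · simp only [hdiv w] at h1
    simp only [hvv] at h1
    rw [prod_odd_zpow hs0 hw] at h1
    have hwN : w ^ N ≠ 0 := pow_ne_zero _ hw
    have hsum : ∑ k ∈ Finset.Ico (-N : ℤ) N,
        (-1) ^ k * s ^ (k * (k + 1)) / (1 - w * s ^ (2 * k + 1)) /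
        (qPoch (s ^ 2) (N + k).toNat * qPoch (s ^ 2) (N - 1 - k).toNat) =
        (-1) ^ N * (s ^ (N * N))⁻¹ * ∑ i ∈ Finset.range (2 * N),
          v i ^ N / ((∏ j ∈ (Finset.range (2 * N)).erase i, (1 - (s ^ 2) ^ ((j : ℤ) - i))) *
          (1 - w * s ^ (2 * ((i : ℤ) - N) + 1))) := by
      rw [Finset.mul_sum]
      symm
      refine Finset.sum_nbij' (fun i => (i : ℤ) - N) (fun j => (j + N).toNat) ?_ ?_ ?_ ?_ ?_
      · intro i hi; simp at hi ⊢; omega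
      · intro i hi; simp at hi ⊢; omega
      · intro i hi; simp
      · intro i hi; simp at hi ⊢; omega
      · intro i hi
        replace hi := Finset.mem_range.mp hi
        rw [show ((N : ℤ) + ((i : ℤ) - N)).toNat = i by omega,
          show ((N : ℤ) - 1 - ((i : ℤ) - N)).toNat = 2 * N - 1 - i by omega,
          prod_erase_one_sub_zpow hq0 hi]
        have e1 : ∏ j ∈ Finset.range i, ((s ^ 2) ^ (j + 1))⁻¹ = s ^ (-((i : ℤ) * (i + 1))) := by
          clear hi
          induction i with
          | zero => simp
          | succ i ih =>
            rw [Finset.prod_range_succ, ih, ← pow_mul, ← zpow_natCast, ← zpow_neg,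
              ← zpow_add₀ hs0]
            congr 1; push_cast; ring
        have e2 : (s ^ (N * N))⁻¹ = s ^ (-((N * N : ℕ) : ℤ)) := by rw [zpow_neg, zpow_natCast]
        have e3 : v i ^ N = s ^ (-(2 * ((i : ℤ) - N) + 1) * N) := by
          rw [hv, ← zpow_natCast, ← zpow_mul]
        rw [e1, e2, e3, zpow_sub₀ (by norm_num : (-1 : ℂ) ≠ 0), zpow_natCast, zpow_natCast]
        have e4 : s ^ (((i : ℤ) - N) * ((i : ℤ) - N + 1)) * s ^ (-((i : ℤ) * (i + 1))) =
            s ^ (-((N * N : ℕ) : ℤ)) * s ^ (-(2 * ((i : ℤ) - N) + 1) * N) := by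
          rw [← zpow_add₀ hs0, ← zpow_add₀ hs0]; congr 1; push_cast; ring
        have h5 : (-1 : ℂ) ^ i ≠ 0 := pow_ne_zero _ (by norm_num)
        have h6 : (-1 : ℂ) ^ N ≠ 0 := pow_ne_zero _ (by norm_num)
        have h7 := hws ((i : ℤ) - N)
        have h8 := qPoch_ne_zero hs i
        have h9 := qPoch_ne_zero hs (2 * N - 1 - i)
        have h10 : s ^ (-((i : ℤ) * (i + 1))) ≠ 0 := zpow_ne_zero _ hs0
        have h11 : ((-1 : ℂ) ^ i) ^ 2 = 1 := by rw [← pow_mul, mul_comm, pow_mul]; simp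
        have h12 : ((-1 : ℂ) ^ N) ^ 2 = 1 := by rw [← pow_mul, mul_comm, pow_mul]; simp
        generalize (1 - w * s ^ (2 * ((i : ℤ) - N) + 1)) = D at *
        generalize s ^ (((i : ℤ) - N) * ((i : ℤ) - N + 1)) = a at *
        generalize s ^ (-((i : ℤ) * (i + 1))) = b at *
        generalize s ^ (-((N * N : ℕ) : ℤ)) = c at *
        generalize s ^ (-(2 * ((i : ℤ) - N) + 1) * N) = d at *
        field_simp
        rw [h11, h12]
        linear_combination -e4
    rw [hsum]
    apply mul_left_cancel₀ hwN
    rw [mul_one]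
    conv_rhs => rw [h1]
    rw [neg_pow w N]
    ring
  · intro i _ j _ hij
    have := zpow_injective_of_norm_lt_one hs0 (by
      rw [norm_pow] at hs; exact (pow_lt_one_iff_of_nonneg (norm_nonneg _) two_ne_zero).mp hs) hij
    omega
  · intro i _ h
    apply hws ((i : ℤ) - N)
    rw [← hdiv, h, div_self (hv0 i), sub_self]

/-! ### Limit of the finite formulas: the reciprocal of theta -/

theorem summable_exp_quadratic {a : ℝ} (ha : 0 < a) (b : ℝ) :
    Summable fun n : ℤ => Real.exp (-a * n ^ 2 + b * n) := by
  have h := (summable_jacobiTheta₂_term_iff ((-(b / (2 * Real.pi)) : ℝ) * Complex.I)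
    ((a / Real.pi : ℝ) * Complex.I)).mpr (by simp; positivity)
  refine h.norm.congr fun n => ?_
  rw [norm_jacobiTheta₂_term, Complex.im_ofReal_mul, Complex.im_ofReal_mul, Complex.I_im]
  congr 1
  have := Real.pi_ne_zero
  field_simp
  ring

theorem summable_zpow_quadratic {r x : ℝ} (hr0 : 0 < r) (hr : r < 1) (hx : 0 < x) :
    Summable fun n : ℤ => r ^ (n * n) * x ^ n := by
  refine (summable_exp_quadratic (neg_pos.mpr (Real.log_neg hr0 hr)) (Real.log x)).congr fun n => ?_
  rw [← Real.rpow_intCast, ← Real.rpow_intCast, Real.rpow_def_of_pos hr0, Real.rpow_def_of_pos hx,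
    ← Real.exp_add]
  congr 1; push_cast; ring

/-- w s^{2n+1} tends to 0 at one end and to infinity at the other, so only finitely many n are
exceptional. Poles need no exclusion, since the inverse of 0 is 0. -/
theorem exists_bound_inv_one_sub {s w : ℂ} (hs0 : s ≠ 0) (hs : ‖s‖ < 1) (hw : w ≠ 0) :
    ∃ C : ℝ, ∀ n : ℤ, ‖(1 - w * s ^ (2 * n + 1))⁻¹‖ ≤ C := by
  have hs0' : 0 < ‖s‖ := norm_pos_iff.mpr hs0
  have hw' : 0 < ‖w‖ := norm_pos_iff.mpr hw
  have hlog := Real.log_neg hs0' hs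
  have hn : ∀ n : ℤ, ‖w * s ^ (2 * n + 1)‖ =
      Real.exp (Real.log ‖w‖ + (2 * n + 1) * Real.log ‖s‖) := by
    intro n
    rw [norm_mul, norm_zpow, Real.exp_add, Real.exp_log hw', ← Real.rpow_intCast,
      Real.rpow_def_of_pos hs0']
    push_cast; ring_nf
  have hev : ∀ᶠ n : ℤ in Filter.cofinite, ‖(1 - w * s ^ (2 * n + 1))⁻¹‖ ≤ 2 := by
    have key : ∀ n : ℤ, (1 / 2 : ℝ) ≤ |1 - ‖w * s ^ (2 * n + 1)‖| →
        ‖(1 - w * s ^ (2 * n + 1))⁻¹‖ ≤ 2 := by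
      intro n h
      have := abs_norm_sub_norm_le 1 (w * s ^ (2 * n + 1))
      rw [norm_one] at this
      rw [norm_inv, show (2 : ℝ) = (1 / 2)⁻¹ by norm_num]
      exact inv_anti₀ (by norm_num) (h.trans this)
    rw [Int.cofinite_eq, Filter.eventually_sup]
    constructor
    · have ht : Filter.Tendsto (fun n : ℤ => ‖w * s ^ (2 * n + 1)‖) Filter.atBot Filter.atTop := by
        simp_rw [hn]
        refine Real.tendsto_exp_atTop.comp (Filter.tendsto_atTop_add_const_left _ _ ?_)
        refine Filter.Tendsto.atBot_mul_const_of_neg hlog ?_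
        exact Filter.tendsto_atBot_add_const_right _ _
          (Filter.Tendsto.const_mul_atBot two_pos (tendsto_intCast_atBot_iff.mpr Filter.tendsto_id))
      filter_upwards [ht.eventually_ge_atTop 2] with n h
      exact key n (by rw [abs_sub_comm]; exact le_trans (by linarith) (le_abs_self _))
    · have ht : Filter.Tendsto (fun n : ℤ => ‖w * s ^ (2 * n + 1)‖) Filter.atTop (nhds 0) := by
        simp_rw [hn]
        refine Real.tendsto_exp_atBot.comp (Filter.tendsto_atBot_add_const_left _ _ ?_)
        refine Filter.Tendsto.atTop_mul_const_of_neg hlog ?_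
        exact Filter.tendsto_atTop_add_const_right _ _
          (Filter.Tendsto.const_mul_atTop two_pos (tendsto_intCast_atTop_iff.mpr Filter.tendsto_id))
      filter_upwards [ht.eventually_le_const (show (0 : ℝ) < 1 / 2 by norm_num)] with n h
      exact key n (le_trans (by linarith) (le_abs_self _))
  have hfin := Filter.eventually_cofinite.mp hev
  obtain ⟨C, hC⟩ := (hfin.image fun n : ℤ => ‖(1 - w * s ^ (2 * n + 1))⁻¹‖).bddAbove
  refine ⟨max 2 C, fun n => ?_⟩
  by_cases h : ‖(1 - w * s ^ (2 * n + 1))⁻¹‖ ≤ 2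
  · exact h.trans (le_max_left _ _)
  · exact (hC ⟨n, h, rfl⟩).trans (le_max_right _ _)

theorem tendsto_qPoch {q : ℂ} (hq : ‖q‖ < 1) :
    Filter.Tendsto (qPoch q) Filter.atTop (nhds (∏' n : ℕ, (1 - q ^ (n + 1)))) :=
  (ModularForm.multipliable_one_sub_pow hq).hasProd.tendsto_prod_nat

theorem tprod_one_sub_pow_ne_zero {q : ℂ} (hq : ‖q‖ < 1) : ∏' n : ℕ, (1 - q ^ (n + 1)) ≠ 0 := by
  refine tprod_one_add_ne_zero_of_summable (f := fun n => -q ^ (n + 1)) ?_ ?_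
  · intro i
    rw [← sub_eq_add_neg]
    exact one_sub_pow_ne_zero hq i
  · simpa using (summable_nat_add_iff 1).mpr (summable_geometric_of_lt_one (norm_nonneg _) hq)

theorem exists_bound_qPoch {q : ℂ} (hq : ‖q‖ < 1) :
    ∃ C : ℝ, 0 ≤ C ∧ ∀ n, ‖qPoch q n‖ ≤ C ∧ ‖(qPoch q n)⁻¹‖ ≤ C := by
  obtain ⟨C1, h1⟩ := (tendsto_qPoch hq).norm.bddAbove_range
  obtain ⟨C2, h2⟩ := ((tendsto_qPoch hq).inv₀ (tprod_one_sub_pow_ne_zero hq)).norm.bddAbove_range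
  exact ⟨max 0 (max C1 C2), le_max_left _ _, fun n =>
    ⟨(h1 ⟨n, rfl⟩).trans ((le_max_left _ _).trans (le_max_right _ _)),
     (h2 ⟨n, rfl⟩).trans ((le_max_right _ _).trans (le_max_right _ _))⟩⟩

theorem tendsto_toNat_add (k : ℤ) :
    Filter.Tendsto (fun N : ℕ => ((N : ℤ) + k).toNat) Filter.atTop Filter.atTop := by
  rw [Filter.tendsto_atTop]
  intro b
  filter_upwards [Filter.eventually_ge_atTop (b + k.natAbs)] with N hN
  omega

/-- Dominated convergence for symmetric partial sums over `ℤ` with convergent coefficients. -/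
theorem tendsto_sum_Icc_mul {f : ℤ → ℂ} (hf : Summable fun n => ‖f n‖) {S : ℕ → Finset ℤ}
    (hS : ∀ j, ∀ᶠ N in Filter.atTop, j ∈ S N) {g : ℕ → ℤ → ℂ} {C : ℝ} (hg : ∀ N j, ‖g N j‖ ≤ C)
    {l : ℂ} (hl : ∀ j, Filter.Tendsto (fun N => g N j) Filter.atTop (nhds l)) :
    Filter.Tendsto (fun N => ∑ j ∈ S N, f j * g N j) Filter.atTop (nhds ((∑' j, f j) * l)) := by
  have h1 : ∀ N, ∑ j ∈ S N, f j * g N j = ∑' j, if j ∈ S N then f j * g N j else 0 := by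
    intro N
    rw [tsum_eq_sum (s := S N) (fun j hj => if_neg hj)]
    exact Finset.sum_congr rfl fun j hj => (if_pos hj).symm
  simp_rw [h1]
  rw [← tsum_mul_right]
  refine tendsto_tsum_of_dominated_convergence (bound := fun j => ‖f j‖ * C) (hf.mul_right C) ?_ ?_
  · intro j
    refine ((hl j).const_mul (f j)).congr' ?_
    filter_upwards [hS j] with N hN
    rw [if_pos hN]
  · refine Filter.Eventually.of_forall fun N j => ?_
    split_ifs
    · rw [norm_mul]
      exact mul_le_mul_of_nonneg_left (hg N j) (norm_nonneg _)
    · rw [norm_zero]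
      exact mul_nonneg (norm_nonneg _) ((norm_nonneg _).trans (hg 0 0))

theorem summable_norm_theta_term {s w : ℂ} (hs0 : s ≠ 0) (hs : ‖s‖ < 1) (hw : w ≠ 0) :
    Summable fun j : ℤ => ‖(-1) ^ j * s ^ (j * j) * w ^ j‖ := by
  refine (summable_zpow_quadratic (norm_pos_iff.mpr hs0) hs (norm_pos_iff.mpr hw)).congr fun n => ?_
  simp

theorem summable_norm_recip_theta_term {s w : ℂ} (hs0 : s ≠ 0) (hs : ‖s‖ < 1) (hw : w ≠ 0) :
    Summable fun k : ℤ => ‖(-1) ^ k * s ^ (k * (k + 1)) / (1 - w * s ^ (2 * k + 1))‖ := by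
  obtain ⟨C, hC⟩ := exists_bound_inv_one_sub hs0 hs hw
  refine Summable.of_nonneg_of_le (fun _ => norm_nonneg _) (fun k => ?_)
    ((summable_norm_theta_term hs0 hs hs0).mul_right C)
  rw [div_eq_mul_inv, norm_mul, mul_add_one, zpow_add₀ hs0, ← mul_assoc]
  exact mul_le_mul_of_nonneg_left (hC k) (norm_nonneg _)

/-- The reciprocal of the theta function as an Appell–Lerch sum. -/
theorem recip_theta_mul_theta {s w : ℂ} (hs0 : s ≠ 0) (hs : ‖s‖ < 1) (hw : w ≠ 0)
    (hws : ∀ n : ℤ, 1 - w * s ^ (2 * n + 1) ≠ 0) :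
    (∑' k : ℤ, (-1) ^ k * s ^ (k * (k + 1)) / (1 - w * s ^ (2 * k + 1))) *
      (∑' j : ℤ, (-1) ^ j * s ^ (j * j) * w ^ j) = (∏' n : ℕ, (1 - (s ^ 2) ^ (n + 1))) ^ 3 := by
  have hq : ‖s ^ 2‖ < 1 := by
    rw [norm_pow]; exact pow_lt_one₀ (norm_nonneg _) hs two_ne_zero
  obtain ⟨C, hC0, hC⟩ := exists_bound_qPoch hq
  have hP := tprod_one_sub_pow_ne_zero hq
  have htP := tendsto_qPoch hq
  set P := ∏' n : ℕ, (1 - (s ^ 2) ^ (n + 1)) with hPdef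
  -- The coefficient ratio tends to 1/P here and to 1/P² in the partial fractions. The finite
  -- product of the two sums is 1, hence the limit P³.
  have t1 := tendsto_sum_Icc_mul (summable_norm_theta_term hs0 hs hw)
    (S := fun N => Finset.Icc (-N : ℤ) N)
    (g := fun N j => qPoch (s ^ 2) (2 * N) /
          (qPoch (s ^ 2) (N + j).toNat * qPoch (s ^ 2) (N - j).toNat)) (C := C * (C * C))
    (l := P / (P * P)) ?_ ?_ ?_
  · have t2 := tendsto_sum_Icc_mul (summable_norm_recip_theta_term hs0 hs hw)
      (S := fun N => Finset.Ico (-N : ℤ) N)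
      (g := fun N j => 1 /
          (qPoch (s ^ 2) (N + j).toNat * qPoch (s ^ 2) (N - 1 - j).toNat)) (C := C * C)
      (l := 1 / (P * P)) ?_ ?_ ?_
    · have t3 := t1.mul t2
      have t4 : Filter.Tendsto (fun _ : ℕ => (1 : ℂ)) Filter.atTop (nhds 1) := tendsto_const_nhds
      have := tendsto_nhds_unique (t3.congr' ?_) t4
      · field_simp at this
        linear_combination this
      · filter_upwards [Filter.eventually_gt_atTop 0] with N hN
        rw [← finite_triple_product hs0 hq hw]
        refine Eq.trans ?_ (finite_partial_fraction hs0 hq hw hws hN)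
        congr 1
        exact Finset.sum_congr rfl fun k _ => mul_one_div _ _
    · intro j
      filter_upwards [Filter.eventually_ge_atTop (j.natAbs + 1)] with N hN
      rw [Finset.mem_Ico]; omega
    · intro N j
      rw [one_div, mul_inv, norm_mul]
      exact mul_le_mul (hC _).2 (hC _).2 (norm_nonneg _) hC0
    · intro j
      have e := (htP.comp (tendsto_toNat_add j)).mul (htP.comp (tendsto_toNat_add (-1 - j)))
      refine (tendsto_const_nhds.div e (mul_ne_zero hP hP)).congr fun N => ?_
      simp only [Function.comp, Pi.div_apply, add_sub, ← sub_eq_add_neg]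
  · intro j
    filter_upwards [Filter.eventually_ge_atTop (j.natAbs + 1)] with N hN
    rw [Finset.mem_Icc]; omega
  · intro N j
    rw [div_eq_mul_inv, mul_inv, norm_mul, norm_mul]
    exact mul_le_mul (hC _).1 (mul_le_mul (hC _).2 (hC _).2 (norm_nonneg _) hC0)
      (by positivity) hC0
  · intro j
    have e := (htP.comp (tendsto_toNat_add j)).mul (htP.comp (tendsto_toNat_add (-j)))
    have e2 : Filter.Tendsto (fun N : ℕ => 2 * N) Filter.atTop Filter.atTop :=
      Filter.tendsto_id.const_mul_atTop' two_pos
    refine ((htP.comp e2).div e (mul_ne_zero hP hP)).congr fun N => ?_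
    simp only [Function.comp, Pi.div_apply, ← sub_eq_add_neg]

/-! ### Powers of q and Gaussian summability -/

theorem qpow_add (τ : ℂ) (x y : ℚ) : qpow τ (x + y) = qpow τ x * qpow τ y := by
  rw [qpow, qpow, qpow, ← Complex.exp_add]; congr 1; push_cast; ring

theorem qpow_zero (τ : ℂ) : qpow τ 0 = 1 := by simp [qpow]

theorem qpow_ne_zero (τ : ℂ) (x : ℚ) : qpow τ x ≠ 0 := Complex.exp_ne_zero _

theorem qpow_zpow (τ : ℂ) (x : ℚ) (n : ℤ) : qpow τ x ^ n = qpow τ (n * x) := by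
  rw [qpow, qpow, ← Complex.exp_int_mul]; congr 1; push_cast; ring

theorem qpow_pow (τ : ℂ) (x : ℚ) (n : ℕ) : qpow τ x ^ n = qpow τ (n * x) := by
  rw [← zpow_natCast, qpow_zpow]; simp

theorem norm_qpow (τ : ℂ) (x : ℚ) : ‖qpow τ x‖ = Real.exp (-(2 * Real.pi * τ.im) * x) := by
  rw [qpow, Complex.norm_exp]
  congr 1
  have : 2 * (Real.pi : ℂ) * Complex.I * τ * (x : ℂ) =
      ((2 * Real.pi * x : ℝ) : ℂ) * (Complex.I * τ) := by push_cast; ring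
  rw [this, Complex.re_ofReal_mul]
  simp
  ring

theorem one_add_abs_le_exp (n : ℤ) : (1 + |(n : ℝ)|) ≤ Real.exp n + Real.exp (-n) := by
  rcases abs_cases (n : ℝ) with ⟨h, _⟩ | ⟨h, _⟩ <;> rw [h]
  · have := Real.add_one_le_exp (n : ℝ)
    have := Real.exp_pos (-(n : ℝ))
    linarith
  · have := Real.add_one_le_exp (-(n : ℝ))
    have := Real.exp_pos (n : ℝ)
    linarith

/-- The weight 1+|n| pays for the lengths of the geometric sums below; being at most e^n + e^{-n},
it only shifts the linear term of the Gaussian. -/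
theorem summable_qpow_mul_zpow {τ : ℂ} (hτ : 0 < τ.im) {W : ℂ} (hW : W ≠ 0) {a : ℚ} (ha : 0 < a)
    (b c : ℚ) (k l : ℤ) : Summable fun n : ℤ =>
      (1 + |(n : ℝ)|) * ‖qpow τ (a * n ^ 2 + b * n + c) * W ^ (k * n + l)‖ := by
  have hW' := norm_pos_iff.mpr hW
  have hA : 0 < 2 * Real.pi * τ.im * a := by
    have : (0 : ℝ) < a := by exact_mod_cast ha
    positivity
  set B := -(2 * Real.pi * τ.im) * b + Real.log ‖W‖ * k with hB
  set D := -(2 * Real.pi * τ.im) * c + Real.log ‖W‖ * l with hD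
  have hn : ∀ n : ℤ, ‖qpow τ (a * n ^ 2 + b * n + c) * W ^ (k * n + l)‖ =
      Real.exp (-(2 * Real.pi * τ.im * a) * n ^ 2 + B * n) * Real.exp D := by
    intro n
    rw [norm_mul, norm_qpow, norm_zpow, ← Real.rpow_intCast, Real.rpow_def_of_pos hW',
      ← Real.exp_add, ← Real.exp_add, hB, hD]
    congr 1; push_cast; ring
  have h1 := (summable_exp_quadratic hA (B + 1)).mul_right (Real.exp D)
  have h2 := (summable_exp_quadratic hA (B - 1)).mul_right (Real.exp D)
  refine Summable.of_nonneg_of_le (fun n => by positivity) (fun n => ?_) (h1.add h2)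
  rw [hn]
  calc _ ≤ (Real.exp n + Real.exp (-n)) *
        (Real.exp (-(2 * Real.pi * τ.im * a) * n ^ 2 + B * n) * Real.exp D) :=
        mul_le_mul_of_nonneg_right (one_add_abs_le_exp n) (by positivity)
    _ = _ := by
        rw [add_mul, ← Real.exp_add, ← Real.exp_add, ← Real.exp_add, ← Real.exp_add,
          ← Real.exp_add]
        congr 2 <;> ring

theorem summable_norm_of_one_add_abs_mul {E : Type*} [NormedAddCommGroup E] {f : ℤ → E}
    (h : Summable fun n : ℤ => (1 + |(n : ℝ)|) * ‖f n‖) : Summable fun n => ‖f n‖ :=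
  Summable.of_nonneg_of_le (fun _ => norm_nonneg _)
    (fun n => le_mul_of_one_le_left (norm_nonneg _) (by linarith [abs_nonneg (n : ℝ)])) h

theorem norm_qpow_lt_one {τ : ℂ} (hτ : 0 < τ.im) {x : ℚ} (hx : 0 < x) : ‖qpow τ x‖ < 1 := by
  rw [norm_qpow, Real.exp_lt_one_iff]
  have : (0 : ℝ) < x := by exact_mod_cast hx
  have := Real.pi_pos
  rw [neg_mul, neg_lt_zero]
  positivity

theorem qpow_half_zpow (τ : ℂ) (n : ℤ) : qpow τ (1 / 2) ^ (2 * n + 1) = qpow τ (n + 1 / 2) := by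
  rw [qpow_zpow]; congr 1; push_cast; ring

theorem exists_bound_inv_one_sub_qpow {τ : ℂ} (hτ : 0 < τ.im) {W : ℂ} (hW : W ≠ 0) :
    ∃ C : ℝ, ∀ n : ℤ, ‖(1 - W * qpow τ (n + 1 / 2))⁻¹‖ ≤ C := by
  simpa only [qpow_half_zpow] using exists_bound_inv_one_sub (qpow_ne_zero τ (1 / 2))
    (norm_qpow_lt_one hτ (by norm_num)) hW

/-! ### The partial fractions of η³/θ -/

/-- The Appell–Lerch sum that is reciprocal to the theta function. -/
noncomputable def recipSeries (τ W : ℂ) : ℂ :=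
  ∑' n : ℤ, (-1) ^ n * qpow τ (((n : ℚ) + 1 / 2) ^ 2 / 2) / (1 - W * qpow τ (n + 1 / 2))

/-- The theta series `∑ (-1) ^ j q ^ (j ^ 2 / 2) W ^ j`. -/
noncomputable def thetaOdd (τ W : ℂ) : ℂ := ∑' j : ℤ, (-1) ^ j * qpow τ ((j : ℚ) ^ 2 / 2) * W ^ j

theorem recipSeries_mul_thetaOdd {τ : ℂ} (hτ : 0 < τ.im) {W : ℂ} (hW : W ≠ 0)
    (hW1 : ∀ n : ℤ, 1 - W * qpow τ (n + 1 / 2) ≠ 0) :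
    recipSeries τ W * thetaOdd τ W = ModularForm.eta τ ^ 3 := by
  have h := recip_theta_mul_theta (qpow_ne_zero τ (1 / 2)) (norm_qpow_lt_one hτ (by norm_num)) hW
    (fun n => by rw [qpow_half_zpow]; exact hW1 n)
  have h1 : recipSeries τ W = qpow τ (1 / 8) * ∑' k : ℤ, (-1) ^ k * qpow τ (1 / 2) ^ (k * (k + 1)) /
      (1 - W * qpow τ (1 / 2) ^ (2 * k + 1)) := by
    rw [recipSeries, ← tsum_mul_left]
    refine tsum_congr fun k => ?_
    rw [qpow_half_zpow, qpow_zpow, show ((k : ℚ) + 1 / 2) ^ 2 / 2 =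
      1 / 8 + ((k * (k + 1) : ℤ) : ℚ) * (1 / 2) by push_cast; ring, qpow_add]
    ring
  have h2 : thetaOdd τ W = ∑' j : ℤ, (-1) ^ j * qpow τ (1 / 2) ^ (j * j) * W ^ j := by
    refine tsum_congr fun k => ?_
    rw [qpow_zpow]
    congr 3; push_cast; ring
  have h3 : ModularForm.eta τ = qpow τ (1 / 24) * ∏' n : ℕ, (1 - (qpow τ (1 / 2) ^ 2) ^ (n + 1)) := by
    rw [ModularForm.eta]
    congr 1
    · rw [Function.Periodic.qParam, qpow]; congr 1; push_cast; ring
    · refine tprod_congr fun n => ?_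
      rw [ModularForm.eta_q_eq_pow, qpow_pow, qpow]
      congr 3; push_cast; ring
  have h4 : qpow τ (1 / 24) ^ 3 = qpow τ (1 / 8) := by rw [qpow_pow]; norm_num
  rw [h1, h2, h3, mul_assoc, h, mul_pow, h4]

theorem neg_one_zpow_congr {a b : ℤ} (h : Even (a - b)) : (-1 : ℂ) ^ a = (-1) ^ b := by
  rw [← sub_add_cancel a b, zpow_add₀ (by norm_num), h.neg_one_zpow, one_mul]

theorem thetaOdd_inv (τ W : ℂ) : thetaOdd τ W⁻¹ = thetaOdd τ W := by
  rw [thetaOdd, thetaOdd, ← (Equiv.neg ℤ).tsum_eq]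
  refine tsum_congr fun j => ?_
  rw [Equiv.neg_apply, inv_zpow', neg_neg, neg_one_zpow_congr (a := -j) (b := j) ⟨-j, by ring⟩]
  push_cast
  rw [neg_sq]

/-! ### Signed geometric sums -/

/-- The indicator of `[A, B)` minus that of `[B, A)`. -/
noncomputable def sgnIco (A B a : ℤ) : ℂ :=
  if A ≤ a ∧ a < B then 1 else if B ≤ a ∧ a < A then -1 else 0

theorem sgnIco_swap (A B a : ℤ) : sgnIco A B a = -sgnIco B A a := by
  unfold sgnIco
  split_ifs <;> first | omega | simp

theorem norm_sgnIco_le (A B a : ℤ) : ‖sgnIco A B a‖ ≤ 1 := by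
  unfold sgnIco
  split_ifs <;> simp

theorem sum_Ico_zpow {u : ℂ} (hu0 : u ≠ 0) (hu : 1 - u ≠ 0) {A B : ℤ} (h : A ≤ B) :
    ∑ a ∈ Finset.Ico A B, u ^ a = (u ^ A - u ^ B) / (1 - u) := by
  induction B, h using Int.leInduction with
  | base => simp
  | succ B h ih =>
    rw [← Finset.insert_Ico_right_eq_Ico_add_one h, Finset.sum_insert (by simp), ih,
      zpow_add_one₀ hu0]
    field_simp
    ring

/-- The sign convention makes the geometric sum formula valid for either order of A and B. -/
theorem hasSum_sgnIco {u : ℂ} (hu0 : u ≠ 0) (hu : 1 - u ≠ 0) (A B : ℤ) :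
    HasSum (fun a => sgnIco A B a * u ^ a) ((u ^ A - u ^ B) / (1 - u)) := by
  have key : ∀ A B : ℤ, A ≤ B →
      HasSum (fun a => sgnIco A B a * u ^ a) ((u ^ A - u ^ B) / (1 - u)) := by
    intro A B h
    rw [← sum_Ico_zpow hu0 hu h]
    have : ∑ a ∈ Finset.Ico A B, u ^ a = ∑ a ∈ Finset.Ico A B, sgnIco A B a * u ^ a := by
      refine Finset.sum_congr rfl fun a ha => ?_
      rw [sgnIco, if_pos (Finset.mem_Ico.mp ha), one_mul]
    rw [this]
    refine hasSum_sum_of_ne_finset_zero fun a ha => ?_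
    rw [Finset.mem_Ico] at ha
    rw [sgnIco, if_neg ha, if_neg (by omega), zero_mul]
  rcases le_total A B with h | h
  · exact key A B h
  · have h1 := (key B A h).neg
    rw [← neg_div, neg_sub] at h1
    refine h1.congr_fun fun a => ?_
    rw [sgnIco_swap]; ring

theorem zpow_le_add_of_mem {x : ℝ} (hx : 0 < x) {A B a : ℤ} (h1 : A ≤ a) (h2 : a ≤ B) :
    x ^ a ≤ x ^ A + x ^ B := by
  have hA := zpow_pos hx A
  have hB := zpow_pos hx B
  rcases le_total x 1 with h | h
  · have := zpow_le_zpow_right_of_le_one₀ hx h h1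
    linarith
  · have := zpow_le_zpow_right₀ h h2
    linarith

theorem summable_norm_sgnIco_mul (u : ℂ) (A B : ℤ) : Summable fun a => ‖sgnIco A B a * u ^ a‖ := by
  refine summable_of_ne_finset_zero (s := Finset.Ico A B ∪ Finset.Ico B A) fun a ha => ?_
  simp only [Finset.mem_union, Finset.mem_Ico, not_or] at ha
  rw [sgnIco, if_neg ha.1, if_neg ha.2, zero_mul, norm_zero]

/-- ‖u‖^a is monotone in a, one way or the other, so each term is bounded by the sum of the two end
values. -/
theorem tsum_norm_sgnIco_le {u : ℂ} (hu0 : u ≠ 0) (A B : ℤ) :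
    ∑' a, ‖sgnIco A B a * u ^ a‖ ≤ |((B - A : ℤ) : ℝ)| * (‖u‖ ^ A + ‖u‖ ^ B) := by
  have hu := norm_pos_iff.mpr hu0
  have key : ∀ A B : ℤ, A ≤ B →
      ∑' a, ‖sgnIco A B a * u ^ a‖ ≤ |((B - A : ℤ) : ℝ)| * (‖u‖ ^ A + ‖u‖ ^ B) := by
    intro A B h
    rw [tsum_eq_sum (s := Finset.Ico A B)]
    · calc _ ≤ ∑ a ∈ Finset.Ico A B, (‖u‖ ^ A + ‖u‖ ^ B) := by
            refine Finset.sum_le_sum fun a ha => ?_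
            rw [Finset.mem_Ico] at ha
            rw [norm_mul, norm_zpow]
            calc _ ≤ 1 * ‖u‖ ^ a :=
                  mul_le_mul_of_nonneg_right (norm_sgnIco_le _ _ _) (zpow_pos hu _).le
              _ ≤ _ := by rw [one_mul]; exact zpow_le_add_of_mem hu ha.1 ha.2.le
        _ = _ := by
            rw [Finset.sum_const, Int.card_Ico, nsmul_eq_mul]
            congr 1
            rw [abs_of_nonneg (by exact_mod_cast sub_nonneg.mpr h)]
            exact_mod_cast Int.toNat_of_nonneg (sub_nonneg.mpr h)
    · intro a ha
      rw [Finset.mem_Ico] at ha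
      rw [sgnIco, if_neg ha, if_neg (by omega), zero_mul, norm_zero]
  rcases le_total A B with h | h
  · exact key A B h
  · have := key B A h
    simp_rw [sgnIco_swap A B, neg_mul, norm_neg]
    rw [add_comm (‖u‖ ^ A), ← neg_sub A B, Int.cast_neg, abs_neg]
    exact this

/-! ### Cancellation of the poles -/

/-- The general term of `θ^{(-)}_{p-m-1/2,m+1/2}(τ,0)`. -/
noncomputable def shiftCoeff (m p : ℕ) (τ : ℂ) (J : ℤ) : ℂ :=
  (-1) ^ J * qpow τ (((m : ℚ) + 1 / 2) * (J - 1 / 2 + p / (2 * m + 1)) ^ 2)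

/-- The series `θ^{(-)}_{p,m+1/2}` in the variable `W`. -/
noncomputable def thetaP (m p : ℕ) (τ W : ℂ) : ℂ :=
  ∑' j : ℤ, (-1) ^ j * qpow τ (((m : ℚ) + 1 / 2) * (j + p / (2 * m + 1)) ^ 2) *
    W ^ ((2 * m + 1) * j + p)

/-- The series `Φ_1^{[m,0]}` in the variable `W`. -/
noncomputable def appell (m : ℕ) (τ W : ℂ) : ℂ :=
  ∑' n : ℤ, W ^ (2 * m * n) * qpow τ ((m : ℚ) * n ^ 2) / (1 - W * qpow τ (n + 1 / 2))

theorem summable_shiftCoeff (m p : ℕ) {τ : ℂ} (hτ : 0 < τ.im) :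
    Summable fun J : ℤ => (1 + |(J : ℝ)|) * ‖shiftCoeff m p τ J‖ := by
  refine (summable_qpow_mul_zpow hτ one_ne_zero (a := (m : ℚ) + 1 / 2) (by positivity)
    (((m : ℚ) + 1 / 2) * 2 * (-1 / 2 + p / (2 * m + 1)))
    (((m : ℚ) + 1 / 2) * (-1 / 2 + p / (2 * m + 1)) ^ 2) 0 0).congr fun J => ?_
  rw [shiftCoeff, one_zpow, mul_one, norm_mul, norm_zpow, norm_neg, norm_one, one_zpow, one_mul]
  congr 3; ring

theorem summable_thetaP_term (m p : ℕ) {τ : ℂ} (hτ : 0 < τ.im) {W : ℂ} (hW : W ≠ 0) :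
    Summable fun j : ℤ => (1 + |(j : ℝ)|) *
      ‖(-1) ^ j * qpow τ (((m : ℚ) + 1 / 2) * (j + p / (2 * m + 1)) ^ 2) *
        W ^ ((2 * m + 1) * j + p)‖ := by
  refine (summable_qpow_mul_zpow hτ hW (a := (m : ℚ) + 1 / 2) (by positivity)
    (((m : ℚ) + 1 / 2) * 2 * (p / (2 * m + 1)))
    (((m : ℚ) + 1 / 2) * (p / (2 * m + 1)) ^ 2) (2 * m + 1) p).congr fun J => ?_
  rw [mul_assoc ((-1 : ℂ) ^ J), norm_mul ((-1 : ℂ) ^ J), norm_zpow, norm_neg, norm_one, one_zpow, one_mul]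
  congr 4; ring

theorem summable_appell_num {m : ℕ} (hm : 1 ≤ m) {τ : ℂ} (hτ : 0 < τ.im) {W : ℂ} (hW : W ≠ 0) :
    Summable fun n : ℤ => (1 + |(n : ℝ)|) * ‖W ^ (2 * m * n) * qpow τ ((m : ℚ) * n ^ 2)‖ := by
  refine (summable_qpow_mul_zpow hτ hW (a := (m : ℚ)) (by exact_mod_cast hm) 0 0
    (2 * m) 0).congr fun n => ?_
  rw [mul_comm (W ^ _)]
  congr 3
  · congr 1; ring
  · rw [add_zero]

theorem summable_recip_num {τ : ℂ} (hτ : 0 < τ.im) :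
    Summable fun n : ℤ => (1 + |(n : ℝ)|) *
      ‖(-1 : ℂ) ^ n * qpow τ (((n : ℚ) + 1 / 2) ^ 2 / 2)‖ := by
  refine (summable_qpow_mul_zpow hτ one_ne_zero (a := 1 / 2) (by norm_num) (1 / 2) (1 / 8)
    0 0).congr fun n => ?_
  rw [one_zpow, mul_one, norm_mul, norm_zpow, norm_neg, norm_one, one_zpow, one_mul]
  congr 3; ring

theorem summable_norm_div {f d : ℤ → ℂ} (hf : Summable fun n => ‖f n‖) {C : ℝ}
    (hC : ∀ n, ‖(d n)⁻¹‖ ≤ C) : Summable fun n => ‖f n / d n‖ := by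
  refine Summable.of_nonneg_of_le (fun _ => norm_nonneg _) (fun n => ?_) (hf.mul_right C)
  rw [div_eq_mul_inv, norm_mul]
  exact mul_le_mul_of_nonneg_left (hC n) (norm_nonneg _)

/-- The factor of the triple series that does not depend on the exponent of `W`. -/
noncomputable def pairCoeff (m p : ℕ) (τ : ℂ) (x : ℤ × ℤ) : ℂ :=
  shiftCoeff m p τ x.2 * qpow τ (-(m : ℚ) * ((x.1 : ℚ) + 1 / 2) ^ 2)

theorem zpow_mul_qpow {τ W : ℂ} (n a : ℤ) : (W * qpow τ (n + 1 / 2)) ^ a =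
    W ^ a * qpow τ (a * ((n : ℚ) + 1 / 2)) := by
  rw [mul_zpow, qpow_zpow]

/-- With X = J+n+p/(2m+1) and Y = n+1/2 the exponents obey (m+½)(X-Y)² - mY² + (2m+1)XY = (m+½)X² +
Y²/2. Thus this end decouples in the coordinates (n, J+n). -/
theorem pairCoeff_mul_upper (m p : ℕ) (τ W : ℂ) (x : ℤ × ℤ) :
    pairCoeff m p τ x * (W * qpow τ (x.1 + 1 / 2)) ^ ((2 * m + 1) * (x.2 + x.1) + p) =
      ((-1) ^ x.1 * qpow τ (((x.1 : ℚ) + 1 / 2) ^ 2 / 2)) *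
      ((-1) ^ (x.2 + x.1) * qpow τ (((m : ℚ) + 1 / 2) * ((x.2 + x.1 : ℤ) + p / (2 * m + 1)) ^ 2) *
        W ^ ((2 * m + 1) * (x.2 + x.1) + p)) := by
  have h1 : (-1 : ℂ) ^ (x.2 + x.1) = (-1) ^ x.2 * (-1) ^ x.1 := zpow_add₀ (by norm_num) _ _
  have h2 : (-1 : ℂ) ^ x.1 * (-1) ^ x.1 = 1 := by rw [← mul_zpow]; norm_num
  have h3 : qpow τ (((m : ℚ) + 1 / 2) * (x.2 - 1 / 2 + p / (2 * m + 1)) ^ 2) *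
      qpow τ (-(m : ℚ) * ((x.1 : ℚ) + 1 / 2) ^ 2) *
      qpow τ ((((2 * m + 1) * (x.2 + x.1) + p : ℤ) : ℚ) * ((x.1 : ℚ) + 1 / 2)) =
      qpow τ (((x.1 : ℚ) + 1 / 2) ^ 2 / 2) *
      qpow τ (((m : ℚ) + 1 / 2) * ((x.2 + x.1 : ℤ) + p / (2 * m + 1)) ^ 2) := by
    rw [← qpow_add, ← qpow_add, ← qpow_add]
    congr 1
    have : (2 * (m : ℚ) + 1) ≠ 0 := by positivity
    push_cast
    field_simp
    ring
  rw [zpow_mul_qpow, pairCoeff, shiftCoeff, h1]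
  linear_combination (-1 : ℂ) ^ x.2 * W ^ ((2 * m + 1) * (x.2 + x.1) + (p : ℤ)) * h3 -
    (-1 : ℂ) ^ x.2 * W ^ ((2 * m + 1) * (x.2 + x.1) + (p : ℤ)) *
      qpow τ (((x.1 : ℚ) + 1 / 2) ^ 2 / 2) *
      qpow τ (((m : ℚ) + 1 / 2) * ((x.2 + x.1 : ℤ) + p / (2 * m + 1)) ^ 2) * h2

/-- Here -m(n+½)² + 2mn(n+½) = mn² - m/4, so this end decouples in (n, J) itself. -/
theorem pairCoeff_mul_lower (m p : ℕ) (τ W : ℂ) (x : ℤ × ℤ) :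
    pairCoeff m p τ x * (W * qpow τ (x.1 + 1 / 2)) ^ (2 * m * x.1) =
      (W ^ (2 * m * x.1) * qpow τ ((m : ℚ) * x.1 ^ 2)) *
        (qpow τ (-(m : ℚ) / 4) * shiftCoeff m p τ x.2) := by
  have h3 : qpow τ (-(m : ℚ) * ((x.1 : ℚ) + 1 / 2) ^ 2) *
      qpow τ (((2 * m * x.1 : ℤ) : ℚ) * ((x.1 : ℚ) + 1 / 2)) =
      qpow τ ((m : ℚ) * x.1 ^ 2) * qpow τ (-(m : ℚ) / 4) := by
    rw [← qpow_add, ← qpow_add]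
    congr 1
    push_cast
    ring
  rw [zpow_mul_qpow, pairCoeff]
  linear_combination shiftCoeff m p τ x.2 * W ^ (2 * m * x.1) * h3

/-- The shear `(n, J) ↦ (n, J + n)`. -/
def shear : ℤ × ℤ ≃ ℤ × ℤ := Equiv.prodShear (Equiv.refl ℤ) (fun n => Equiv.addRight n)

theorem shear_apply (x : ℤ × ℤ) : shear x = (x.1, x.2 + x.1) := rfl

/-- The upper end of the geometric sums. -/
def upperEnd (m p : ℕ) (x : ℤ × ℤ) : ℤ := (2 * m + 1) * (x.2 + x.1) + p

/-- The two products have the same coefficients and denominators and differ only in the power of u =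
W q^{n+1/2} upstairs; the difference of these powers over 1-u is a polynomial in u and u⁻¹. -/
theorem recipSeries_mul_thetaP {m : ℕ} (hm : 1 ≤ m) (p : ℕ) {τ : ℂ} (hτ : 0 < τ.im) {W : ℂ}
    (hW : W ≠ 0) (hW1 : ∀ n : ℤ, 1 - W * qpow τ (n + 1 / 2) ≠ 0) :
    recipSeries τ W * thetaP m p τ W =
      qpow τ (-(m : ℚ) / 4) * (∑' J, shiftCoeff m p τ J) * appell m τ W -
      ∑' x : ℤ × ℤ, ∑' a : ℤ, pairCoeff m p τ x *
        (sgnIco (2 * m * x.1) (upperEnd m p x) a * (W * qpow τ (x.1 + 1 / 2)) ^ a) := by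
  obtain ⟨C, hC⟩ := exists_bound_inv_one_sub_qpow hτ hW
  have s1 := summable_norm_div (summable_norm_of_one_add_abs_mul (summable_recip_num hτ)) hC
  have s2 := summable_norm_of_one_add_abs_mul (summable_thetaP_term m p hτ hW)
  have s3 := summable_norm_div
    (summable_norm_of_one_add_abs_mul (summable_appell_num hm hτ hW)) hC
  have s4 : Summable fun J => ‖qpow τ (-(m : ℚ) / 4) * shiftCoeff m p τ J‖ := by
    simp_rw [norm_mul]
    exact (summable_norm_of_one_add_abs_mul (summable_shiftCoeff m p hτ)).mul_left _
  have e1 : recipSeries τ W * thetaP m p τ W = ∑' x : ℤ × ℤ, pairCoeff m p τ x *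
      (W * qpow τ (x.1 + 1 / 2)) ^ upperEnd m p x / (1 - W * qpow τ (x.1 + 1 / 2)) := by
    rw [recipSeries, thetaP, tsum_mul_tsum_of_summable_norm s1 s2, ← shear.tsum_eq]
    refine tsum_congr fun x => ?_
    rw [upperEnd, pairCoeff_mul_upper, shear_apply]
    ring
  have e2 : qpow τ (-(m : ℚ) / 4) * (∑' J, shiftCoeff m p τ J) * appell m τ W =
      ∑' x : ℤ × ℤ, pairCoeff m p τ x *
      (W * qpow τ (x.1 + 1 / 2)) ^ (2 * m * x.1) / (1 - W * qpow τ (x.1 + 1 / 2)) := by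
    rw [← tsum_mul_left, mul_comm, appell, tsum_mul_tsum_of_summable_norm s3 s4]
    refine tsum_congr fun x => ?_
    rw [pairCoeff_mul_lower]
    ring
  have t1 : Summable fun x : ℤ × ℤ => pairCoeff m p τ x *
      (W * qpow τ (x.1 + 1 / 2)) ^ upperEnd m p x / (1 - W * qpow τ (x.1 + 1 / 2)) := by
    refine ((shear.summable_iff).mpr (summable_mul_of_summable_norm s1 s2)).congr fun x => ?_
    rw [upperEnd, pairCoeff_mul_upper, Function.comp, shear_apply]
    ring
  have t2 : Summable fun x : ℤ × ℤ => pairCoeff m p τ x *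
      (W * qpow τ (x.1 + 1 / 2)) ^ (2 * m * x.1) / (1 - W * qpow τ (x.1 + 1 / 2)) := by
    refine (summable_mul_of_summable_norm s3 s4).congr fun x => ?_
    rw [pairCoeff_mul_lower]
    ring
  rw [e1, e2, eq_sub_iff_add_eq', ← eq_sub_iff_add_eq, ← t2.tsum_sub t1]
  refine tsum_congr fun x => ?_
  have hu0 : W * qpow τ (x.1 + 1 / 2) ≠ 0 := mul_ne_zero hW (qpow_ne_zero _ _)
  rw [tsum_mul_left, (hasSum_sgnIco hu0 (hW1 x.1) _ _).tsum_eq]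
  ring

/-- This justifies collecting powers of W. The sum over a is at most its length times the two end
values, and each end value is a product of two Gaussian terms. -/
theorem summable_triple {m : ℕ} (hm : 1 ≤ m) (p : ℕ) {τ : ℂ} (hτ : 0 < τ.im) {W : ℂ}
    (hW : W ≠ 0) : Summable fun y : (ℤ × ℤ) × ℤ => pairCoeff m p τ y.1 *
        (sgnIco (2 * m * y.1.1) (upperEnd m p y.1) y.2 * (W * qpow τ (y.1.1 + 1 / 2)) ^ y.2) := by
  apply Summable.of_norm
  rw [summable_prod_of_nonneg fun _ => norm_nonneg _]
  constructor
  · intro x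
    simp_rw [norm_mul (pairCoeff m p τ x)]
    exact (summable_norm_sgnIco_mul _ _ _).mul_left _
  have b1 := (summable_appell_num hm hτ hW).mul_of_nonneg (summable_shiftCoeff m p hτ)
    (fun n => by positivity) (fun n => by positivity)
  have b2 := (summable_recip_num hτ).mul_of_nonneg (summable_thetaP_term m p hτ hW)
    (fun n => by positivity) (fun n => by positivity)
  have b3 := (shear.summable_iff).mpr b2
  refine Summable.of_nonneg_of_le (fun x => tsum_nonneg fun _ => norm_nonneg _) (fun x => ?_)
    (((b1.mul_left ‖qpow τ (-(m : ℚ) / 4)‖).add b3).mul_left (2 * m + 1 + p : ℝ))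
  have hu0 : W * qpow τ (x.1 + 1 / 2) ≠ 0 := mul_ne_zero hW (qpow_ne_zero _ _)
  simp_rw [norm_mul (pairCoeff m p τ x)]
  rw [tsum_mul_left]
  have c1 : ‖pairCoeff m p τ x‖ * ‖W * qpow τ (x.1 + 1 / 2)‖ ^ (2 * m * x.1) =
      ‖qpow τ (-(m : ℚ) / 4)‖ * (‖W ^ (2 * m * x.1) * qpow τ ((m : ℚ) * x.1 ^ 2)‖ *
        ‖shiftCoeff m p τ x.2‖) := by
    rw [← norm_zpow, ← norm_mul, pairCoeff_mul_lower, norm_mul, norm_mul (qpow τ (-(m : ℚ) / 4))]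
    ring
  have c2 : ‖pairCoeff m p τ x‖ * ‖W * qpow τ (x.1 + 1 / 2)‖ ^ upperEnd m p x =
      ‖(-1 : ℂ) ^ x.1 * qpow τ (((x.1 : ℚ) + 1 / 2) ^ 2 / 2)‖ *
      ‖(-1) ^ (x.2 + x.1) * qpow τ (((m : ℚ) + 1 / 2) * ((x.2 + x.1 : ℤ) + p / (2 * m + 1)) ^ 2) *
        W ^ ((2 * m + 1) * (x.2 + x.1) + p)‖ := by
    rw [← norm_zpow, ← norm_mul, upperEnd, pairCoeff_mul_upper, norm_mul]
  -- The length is bounded twice, here in n and J and in `d2` in n and J+n, to match the coordinates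
  -- in which each end factors.
  have d1 : |((upperEnd m p x - 2 * m * x.1 : ℤ) : ℝ)| ≤
      (2 * m + 1 + p) * ((1 + |(x.1 : ℝ)|) * (1 + |(x.2 : ℝ)|)) := by
    have : ((upperEnd m p x - 2 * m * x.1 : ℤ) : ℝ) = (2 * m + 1) * x.2 + x.1 + p := by
      rw [upperEnd]; push_cast; ring
    rw [this]
    have h1 := abs_add_le ((2 * m + 1) * (x.2 : ℝ) + x.1) p
    have h2 := abs_add_le ((2 * m + 1) * (x.2 : ℝ)) x.1
    rw [abs_mul, abs_of_pos (by positivity : (0 : ℝ) < 2 * m + 1)] at h2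
    rw [Nat.abs_cast] at h1
    have := abs_nonneg (x.1 : ℝ)
    have := abs_nonneg (x.2 : ℝ)
    have hm0 : (0 : ℝ) ≤ m := Nat.cast_nonneg _
    have hp0 : (0 : ℝ) ≤ p := Nat.cast_nonneg _
    generalize |(x.1 : ℝ)| = X at *
    generalize |(x.2 : ℝ)| = Y at *
    have := mul_nonneg hp0 (by positivity : 0 ≤ X * Y + X + Y)
    have := mul_nonneg hm0 (by positivity : 0 ≤ X * Y + X)
    have : 0 ≤ X * Y := by positivity
    nlinarith
  have d2 : |((upperEnd m p x - 2 * m * x.1 : ℤ) : ℝ)| ≤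
      (2 * m + 1 + p) * ((1 + |(x.1 : ℝ)|) * (1 + |((x.2 + x.1 : ℤ) : ℝ)|)) := by
    have : ((upperEnd m p x - 2 * m * x.1 : ℤ) : ℝ) =
        (2 * m + 1) * ((x.2 + x.1 : ℤ) : ℝ) + p + -(2 * m * x.1) := by
      rw [upperEnd]; push_cast; ring
    rw [this]
    have h1 := abs_add_le ((2 * m + 1) * ((x.2 + x.1 : ℤ) : ℝ) + p) (-(2 * m * x.1))
    have h2 := abs_add_le ((2 * m + 1) * ((x.2 + x.1 : ℤ) : ℝ)) p
    rw [abs_mul, abs_of_pos (by positivity : (0 : ℝ) < 2 * m + 1), Nat.abs_cast] at h2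
    rw [abs_neg, abs_mul, abs_of_nonneg (by positivity : (0 : ℝ) ≤ 2 * m)] at h1
    have := abs_nonneg (x.1 : ℝ)
    have := abs_nonneg ((x.2 + x.1 : ℤ) : ℝ)
    have hm0 : (0 : ℝ) ≤ m := Nat.cast_nonneg _
    have hp0 : (0 : ℝ) ≤ p := Nat.cast_nonneg _
    generalize |(x.1 : ℝ)| = X at *
    generalize |((x.2 + x.1 : ℤ) : ℝ)| = Y at *
    have := mul_nonneg hp0 (by positivity : 0 ≤ X * Y + X + Y)
    have := mul_nonneg hm0 (by positivity : 0 ≤ X * Y)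
    have : 0 ≤ X * Y := by positivity
    nlinarith
  calc _ ≤ ‖pairCoeff m p τ x‖ * (|((upperEnd m p x - 2 * m * x.1 : ℤ) : ℝ)| *
        (‖W * qpow τ (x.1 + 1 / 2)‖ ^ (2 * m * x.1) +
          ‖W * qpow τ (x.1 + 1 / 2)‖ ^ upperEnd m p x)) :=
        mul_le_mul_of_nonneg_left (tsum_norm_sgnIco_le hu0 _ _) (norm_nonneg _)
    _ = |((upperEnd m p x - 2 * m * x.1 : ℤ) : ℝ)| *
          (‖pairCoeff m p τ x‖ * ‖W * qpow τ (x.1 + 1 / 2)‖ ^ (2 * m * x.1)) +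
        |((upperEnd m p x - 2 * m * x.1 : ℤ) : ℝ)| *
          (‖pairCoeff m p τ x‖ * ‖W * qpow τ (x.1 + 1 / 2)‖ ^ upperEnd m p x) := by ring
    _ ≤ _ := by
        rw [c1, c2]
        refine (add_le_add (mul_le_mul_of_nonneg_right d1 (by positivity))
          (mul_le_mul_of_nonneg_right d2 (by positivity))).trans (le_of_eq ?_)
        simp only [Function.comp, shear_apply]
        ring

/-! ### Indefinite double series over cones -/

noncomputable def rowCoeff (m : ℕ) (τ : ℂ) (k r : ℤ) : ℂ :=
  qpow τ (-(2 * m * ((r : ℚ) + 1 / 2) - k) ^ 2 / (4 * m))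

/-- The general term of the indefinite double series, in shifted coordinates `(r, J)`. -/
noncomputable def coneTerm (m p : ℕ) (τ : ℂ) (k : ℤ) (x : ℤ × ℤ) : ℂ :=
  shiftCoeff m p τ x.2 * rowCoeff m τ k x.1

/-- The form (M+½)J² - Mr² is indefinite, but |r| ≤ |J| + C leaves J²/2 up to linear terms. Half of
that is traded for r²/8, giving decay in both variables. -/
theorem cone_exponent_bound {M β γ C J r : ℝ} (hM : 0 ≤ M) (h : |r| ≤ |J| + C) :
    1 / 4 * J ^ 2 + 1 / 8 * r ^ 2 - ((2 * M + 1) * |β| + 2 * M * (C + |γ|)) * |J| -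
      (M * (C + |γ|) ^ 2 + C ^ 2 / 4) ≤ (M + 1 / 2) * (J + β) ^ 2 - M * (r + γ) ^ 2 := by
  have h1 : (|J| - |β|) ^ 2 ≤ (J + β) ^ 2 := by
    have := abs_mul J β
    have := neg_abs_le (J * β)
    nlinarith [sq_abs J, sq_abs β]
  have h2 : (r + γ) ^ 2 ≤ (|J| + C + |γ|) ^ 2 := by
    rw [← sq_abs (r + γ)]
    have := abs_add_le r γ
    exact pow_le_pow_left₀ (abs_nonneg _) (by linarith) 2
  have h3 : r ^ 2 ≤ 2 * J ^ 2 + 2 * C ^ 2 := by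
    rw [← sq_abs r, ← sq_abs J]
    have := pow_le_pow_left₀ (abs_nonneg _) h 2
    nlinarith [sq_nonneg (|J| - C)]
  have h4 := mul_le_mul_of_nonneg_left h1 (by linarith : 0 ≤ M + 1 / 2)
  have h5 := mul_le_mul_of_nonneg_left h2 hM
  nlinarith [sq_abs J, sq_nonneg β, sq_abs β, mul_nonneg hM (sq_nonneg β)]

theorem norm_coneTerm {m : ℕ} (hm : 1 ≤ m) (p : ℕ) (τ : ℂ) (k : ℤ) (x : ℤ × ℤ) :
    ‖coneTerm m p τ k x‖ = Real.exp (-(2 * Real.pi * τ.im) *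
      (((m : ℝ) + 1 / 2) * ((x.2 : ℝ) + (-1 / 2 + p / (2 * m + 1))) ^ 2 -
        m * ((x.1 : ℝ) + (1 / 2 - k / (2 * m))) ^ 2)) := by
  have hm0 : (m : ℝ) ≠ 0 := by positivity
  rw [coneTerm, shiftCoeff, rowCoeff, norm_mul, norm_mul, norm_zpow, norm_neg, norm_one, one_zpow,
    one_mul, norm_qpow, norm_qpow, ← Real.exp_add]
  congr 1
  push_cast
  field_simp
  ring

theorem summable_exp_cone {y : ℝ} (hy : 0 < y) (D D' : ℝ) :
    Summable fun x : ℤ × ℤ => Real.exp (-y *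
      (1 / 4 * (x.2 : ℝ) ^ 2 + 1 / 8 * (x.1 : ℝ) ^ 2 - D * |(x.2 : ℝ)| - D')) := by
  have s1 := summable_exp_quadratic (by positivity : 0 < y * (1 / 8)) 0
  have s2 := (summable_exp_quadratic (by positivity : 0 < y * (1 / 4)) (y * D)).add
    (summable_exp_quadratic (by positivity : 0 < y * (1 / 4)) (-(y * D)))
  refine Summable.of_nonneg_of_le (fun _ => (Real.exp_pos _).le) (fun x => ?_)
    ((s1.mul_of_nonneg s2 (fun _ => (Real.exp_pos _).le)
      (fun _ => add_nonneg (Real.exp_pos _).le (Real.exp_pos _).le)).mul_left (Real.exp (y * D')))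
  have h0 : Real.exp (-y * (1 / 4 * (x.2 : ℝ) ^ 2 - D * |(x.2 : ℝ)|)) ≤
      Real.exp (-(y * (1 / 4)) * (x.2 : ℝ) ^ 2 + y * D * x.2) +
        Real.exp (-(y * (1 / 4)) * (x.2 : ℝ) ^ 2 + -(y * D) * x.2) := by
    rcases abs_cases (x.2 : ℝ) with ⟨h, _⟩ | ⟨h, _⟩ <;> rw [h]
    · refine le_add_of_le_of_nonneg (le_of_eq ?_) (Real.exp_pos _).le
      congr 1; ring
    · refine le_add_of_nonneg_of_le (Real.exp_pos _).le (le_of_eq ?_)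
      congr 1; ring
  calc _ = Real.exp (y * D') * (Real.exp (-(y * (1 / 8)) * (x.1 : ℝ) ^ 2 + 0 * x.1) *
        Real.exp (-y * (1 / 4 * (x.2 : ℝ) ^ 2 - D * |(x.2 : ℝ)|))) := by
        rw [← Real.exp_add, ← Real.exp_add]; congr 1; ring
    _ ≤ _ := by gcongr

theorem summable_indicator_coneTerm {m : ℕ} (hm : 1 ≤ m) (p : ℕ) {τ : ℂ} (hτ : 0 < τ.im) (k : ℤ)
    {R : Set (ℤ × ℤ)} {C : ℕ} (hR : ∀ x ∈ R, x.1.natAbs ≤ x.2.natAbs + C) :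
    Summable (R.indicator (coneTerm m p τ k)) := by
  refine Summable.of_norm_bounded (summable_exp_cone (by positivity : 0 < 2 * Real.pi * τ.im)
    ((2 * (m : ℝ) + 1) * |-1 / 2 + (p : ℝ) / (2 * m + 1)| +
      2 * m * (C + |1 / 2 - (k : ℝ) / (2 * m)|))
    (m * (C + |1 / 2 - (k : ℝ) / (2 * m)|) ^ 2 + (C : ℝ) ^ 2 / 4)) fun x => ?_
  by_cases hx : x ∈ R
  · rw [Set.indicator_of_mem hx, norm_coneTerm hm]
    have h1 : |(x.1 : ℝ)| ≤ |(x.2 : ℝ)| + C := by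
      have := hR x hx
      rw [← Int.cast_abs, ← Int.cast_abs, Int.abs_eq_natAbs, Int.abs_eq_natAbs]
      exact_mod_cast this
    apply Real.exp_le_exp.mpr
    apply mul_le_mul_of_nonpos_left
    · exact cone_exponent_bound (Nat.cast_nonneg m) h1
    · have : 0 < 2 * Real.pi * τ.im := by positivity
      linarith
  · rw [Set.indicator_of_notMem hx, norm_zero]
    exact (Real.exp_pos _).le

/-- The sign function of the double cone with row cut `ρ` and diagonal cut `c`. -/
noncomputable def coneWt (ρ c : ℤ) (x : ℤ × ℤ) : ℂ :=
  if ρ ≤ x.1 ∧ x.2 + x.1 < c then 1 else if x.1 < ρ ∧ c ≤ x.2 + x.1 then -1 else 0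

noncomputable def coneSum (m p : ℕ) (τ : ℂ) (k ρ c : ℤ) : ℂ :=
  ∑' x : ℤ × ℤ, coneWt ρ c x * coneTerm m p τ k x

theorem summable_coneWt_mul {m : ℕ} (hm : 1 ≤ m) (p : ℕ) {τ : ℂ} (hτ : 0 < τ.im) (k : ℤ)
    (ρ c : ℤ) :
    Summable fun x : ℤ × ℤ => coneWt ρ c x * coneTerm m p τ k x := by
  have h := summable_indicator_coneTerm hm p hτ k (C := ρ.natAbs + c.natAbs)
    (R := {x | (ρ ≤ x.1 ∧ x.2 + x.1 < c) ∨ (x.1 < ρ ∧ c ≤ x.2 + x.1)})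
    (by rintro x (h | h) <;> omega)
  refine Summable.of_norm (h.norm.congr fun x => ?_)
  rw [coneWt, Set.indicator]
  simp only [Set.mem_ofPred_eq]
  split_ifs <;> first | omega | simp

/-- On r+J = c the exponent is a quadratic polynomial in r with leading coefficient ½. The
reflection about its axis sends r to an odd integer minus r, so it preserves the power of q and
flips (-1)^J. -/
theorem coneTerm_reflect {m : ℕ} (hm : 1 ≤ m) (p : ℕ) (τ : ℂ) (k : ℤ)
    (c : ℤ) (x : ℤ × ℤ)
    (hx : x.2 + x.1 = c) :
    coneTerm m p τ k (2 * ((2 * m + 1) * c + p - k) - 1 - x.1,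
      c - (2 * ((2 * m + 1) * c + p - k) - 1 - x.1)) = -coneTerm m p τ k x := by
  obtain ⟨r, J⟩ := x
  obtain rfl : J = c - r := by simp at hx; omega
  have hm0 : (m : ℚ) ≠ 0 := by positivity
  have hm1 : (2 * (m : ℚ) + 1) ≠ 0 := by positivity
  simp only [coneTerm, shiftCoeff, rowCoeff]
  rw [neg_one_zpow_congr (a := c - (2 * ((2 * m + 1) * c + p - k) - 1 - r)) (b := c - r + 1)
    ⟨r - ((2 * m + 1) * c + p - k), by ring⟩, zpow_add_one₀ (by norm_num),
    mul_assoc ((-1 : ℂ) ^ (c - r) * -1), ← qpow_add, mul_assoc ((-1 : ℂ) ^ (c - r)) (qpow τ _),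
    ← qpow_add]
  have : ((m : ℚ) + 1 / 2) * (((c - (2 * ((2 * m + 1) * c + p - k) - 1 - r) : ℤ) : ℚ) - 1 / 2 +
      p / (2 * m + 1)) ^ 2 + -(2 * m * (((2 * ((2 * m + 1) * c + p - k) - 1 - r : ℤ) : ℚ) + 1 / 2)
        - k) ^ 2 / (4 * m) =
      ((m : ℚ) + 1 / 2) * (((c - r : ℤ) : ℚ) - 1 / 2 + p / (2 * m + 1)) ^ 2 +
        -(2 * m * ((r : ℚ) + 1 / 2) - k) ^ 2 / (4 * m) := by
    push_cast
    field_simp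
    ring
  rw [this]
  ring

/-- Moving the cut adds exactly the antidiagonal r+J = c, with weight +1 on both sides of the row
cut. That full line cancels against its reflection. -/
theorem coneSum_add_one_diag {m : ℕ} (hm : 1 ≤ m) (p : ℕ) {τ : ℂ} (hτ : 0 < τ.im) (k : ℤ)
    (ρ c : ℤ) :
    coneSum m p τ k ρ (c + 1) = coneSum m p τ k ρ c := by
  have s1 := summable_coneWt_mul hm p hτ k ρ (c + 1)
  have s2 := summable_coneWt_mul hm p hτ k ρ c
  rw [← sub_eq_zero, coneSum, coneSum, ← s1.tsum_sub s2]
  have h : ∀ x : ℤ × ℤ, coneWt ρ (c + 1) x * coneTerm m p τ k x - coneWt ρ c x * coneTerm m p τ k x =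
      if x.2 + x.1 = c then coneTerm m p τ k x else 0 := by
    intro x
    rw [← sub_mul, coneWt, coneWt]
    split_ifs <;> first | omega | ring
  simp_rw [h]
  set r0 : ℤ := 2 * ((2 * m + 1) * c + p - k) - 1 with hr0
  let e : ℤ × ℤ ≃ ℤ × ℤ :=
    { toFun := fun x => (r0 - x.1, x.2 + 2 * x.1 - r0)
      invFun := fun x => (r0 - x.1, x.2 + 2 * x.1 - r0)
      left_inv := fun x => by ext <;> simp; ring
      right_inv := fun x => by ext <;> simp; ring }
  refine self_eq_neg.mp ?_
  conv_lhs => rw [← e.tsum_eq]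
  rw [← tsum_neg]
  refine tsum_congr fun x => ?_
  have he : (e x).2 + (e x).1 = x.2 + x.1 := by simp only [e, Equiv.coe_fn_mk]; ring
  rw [he]
  split_ifs with hx
  · rw [← coneTerm_reflect hm p τ k c x hx]
    congr 1
    ext
    · rfl
    · simp only [e, Equiv.coe_fn_mk, hr0]; omega
  · simp

theorem coneSum_diag {m : ℕ} (hm : 1 ≤ m) (p : ℕ) {τ : ℂ} (hτ : 0 < τ.im) (k : ℤ)
    (ρ c : ℤ) : coneSum m p τ k ρ c = coneSum m p τ k ρ 0 := by
  induction c using Int.induction_on with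
  | zero => rfl
  | succ i ih => rw [coneSum_add_one_diag hm p hτ, ih]
  | pred i ih => rw [← coneSum_add_one_diag hm p hτ, sub_add_cancel, ih]

/-- The two weights differ by the indicator of the full row r = ρ, over which the sum factors. -/
theorem coneSum_add_one_row {m : ℕ} (hm : 1 ≤ m) (p : ℕ) {τ : ℂ} (hτ : 0 < τ.im) (k : ℤ)
    (ρ c : ℤ) :
    coneSum m p τ k (ρ + 1) c =
      coneSum m p τ k ρ c - rowCoeff m τ k ρ * ∑' J, shiftCoeff m p τ J := by
  have s1 := summable_coneWt_mul hm p hτ k ρ c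
  have s2 := summable_coneWt_mul hm p hτ k (ρ + 1) c
  rw [eq_sub_iff_add_eq', ← eq_sub_iff_add_eq, coneSum, coneSum, ← s1.tsum_sub s2, ← tsum_mul_left]
  have h : ∀ x : ℤ × ℤ, coneWt ρ c x * coneTerm m p τ k x - coneWt (ρ + 1) c x * coneTerm m p τ k x =
      if x.1 = ρ then coneTerm m p τ k x else 0 := by
    intro x
    rw [← sub_mul, coneWt, coneWt]
    split_ifs <;> first | omega | ring
  simp_rw [h]
  have hinj : Function.Injective fun J : ℤ => (ρ, J) := fun a b hab => (Prod.ext_iff.mp hab).2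
  rw [← hinj.tsum_eq]
  · refine tsum_congr fun J => ?_
    simp [coneTerm, mul_comm]
  · intro x hx
    simp only [Function.mem_support, ne_eq, ite_eq_right_iff, Classical.not_imp] at hx
    exact ⟨x.2, by rw [← hx.1]⟩

theorem coneSum_row_nat {m : ℕ} (hm : 1 ≤ m) (p : ℕ) {τ : ℂ} (hτ : 0 < τ.im) (k : ℤ)
    (ρ : ℕ) (c : ℤ) :
    coneSum m p τ k ρ c = coneSum m p τ k 0 c -
      (∑ r ∈ Finset.range ρ, rowCoeff m τ k r) * ∑' J, shiftCoeff m p τ J := by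
  induction ρ with
  | zero => simp
  | succ n ih =>
    rw [Nat.cast_succ, coneSum_add_one_row hm p hτ, ih, Finset.sum_range_succ]
    ring

/-! ### Collecting powers of W by residues modulo 2m -/

/-- The division of an integer by `2 m`, with remainder in `(-m, m]`. -/
def residueEquiv {m : ℕ} (hm : 1 ≤ m) : (Finset.Ioc (-m : ℤ) m) × ℤ ≃ ℤ where
  toFun x := 2 * m * x.2 + x.1
  invFun a := (⟨(a + m - 1) % (2 * m) - m + 1, by
    have h1 := Int.emod_nonneg (a + m - 1) (by omega : (2 * m : ℤ) ≠ 0)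
    have h2 := Int.emod_lt_of_pos (a + m - 1) (by omega : (0 : ℤ) < 2 * m)
    rw [Finset.mem_Ioc]; omega⟩, (a + m - 1) / (2 * m))
  left_inv x := by
    obtain ⟨⟨k, hk⟩, b⟩ := x
    rw [Finset.mem_Ioc] at hk
    have e : 2 * m * b + k + m - 1 = (k + m - 1) + 2 * m * b := by ring
    have h1 : (2 * m * b + k + m - 1) % (2 * m) = k + m - 1 := by
      rw [e, Int.add_mul_emod_self_left, Int.emod_eq_of_lt (by omega) (by omega)]
    have h2 : (2 * m * b + k + m - 1) / (2 * m) = b := by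
      rw [e, Int.add_mul_ediv_left _ _ (by omega), Int.ediv_eq_zero_of_lt (by omega) (by omega),
        zero_add]
    ext
    · simp only [h1]; ring
    · simp only [h2]
  right_inv a := by
    have := Int.emod_add_mul_ediv (a + m - 1) (2 * m)
    simp only
    linarith

theorem tsum_residues {m : ℕ} (hm : 1 ≤ m) {f : ℤ → ℂ} (hf : Summable f) :
    ∑' a, f a = ∑ k ∈ Finset.Ioc (-m : ℤ) m, ∑' b : ℤ, f (2 * m * b + k) := by
  have h : Summable fun x => f (residueEquiv hm x) := (residueEquiv hm).summable_iff.mpr hf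
  rw [← (residueEquiv hm).tsum_eq, h.tsum_prod, tsum_fintype]
  exact Finset.sum_coe_sort (Finset.Ioc (-m : ℤ) m) fun k => ∑' b : ℤ, f (2 * m * b + k)

/-- The theta function `θ_{k,m}` in the variable `W`. -/
noncomputable def thetaInt (m : ℕ) (k : ℤ) (τ W : ℂ) : ℂ :=
  ∑' b : ℤ, qpow τ ((m : ℚ) * ((b : ℚ) + k / (2 * m)) ^ 2) * W ^ (2 * m * b + k)

/-- The position of the row cut in the residue class of `k`. -/
def rowCut (k : ℤ) : ℤ := if 0 ≤ k then 1 else 0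

/-- After n = r+b, the lower end condition reads 2mr ≤ k; as |k| ≤ m < 2m this is r ≤ 0 for k ≥ 0
and r < 0 for k < 0, independently of b. The upper end compares r+J with a floor that does depend on
b. -/
theorem sgnIco_eq_neg_coneWt {m : ℕ} (p : ℕ) {k : ℤ} (hk : k ∈ Finset.Ioc (-m : ℤ) m)
    (b : ℤ) (x : ℤ × ℤ) :
    sgnIco (2 * m * (x.1 + b)) (upperEnd m p (x.1 + b, x.2)) (2 * m * b + k) =
      -coneWt (rowCut k) ((k - b - p) / (2 * m + 1) + 1) x := by
  rw [Finset.mem_Ioc] at hk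
  have h1 : 2 * m * (x.1 + b) ≤ 2 * m * b + k ↔ x.1 < rowCut k := by
    have e : 2 * m * (x.1 + b) ≤ 2 * m * b + k ↔ 2 * m * x.1 ≤ k := by
      constructor <;> intro h <;> linarith
    rw [e, rowCut]
    split_ifs with h0
    · constructor
      · intro h
        by_contra hc
        nlinarith
      · intro h
        nlinarith
    · constructor
      · intro h
        by_contra hc
        nlinarith
      · intro h
        nlinarith
  have h2 : upperEnd m p (x.1 + b, x.2) ≤ 2 * m * b + k ↔
      x.2 + x.1 < (k - b - p) / (2 * m + 1) + 1 := by
    rw [Int.lt_add_one_iff, Int.le_ediv_iff_mul_le (by omega), upperEnd]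
    constructor <;> intro h <;> linarith
  rw [sgnIco, coneWt]
  generalize 2 * m * (x.1 + b) = A at *
  generalize upperEnd m p (x.1 + b, x.2) = B at *
  generalize 2 * m * b + k = a at *
  generalize (k - b - p) / (2 * m + 1) + 1 = c at *
  generalize rowCut k = ρ at *
  split_ifs <;> first | omega | simp

/-- Completing the square: with e = r+b+½ and f = b+k/(2m), -me² + 2mfe = mf² - m(e-f)². The first
square is the exponent of θ_{k,m}, the second that of `rowCoeff`. -/
theorem pairCoeff_shift {m : ℕ} (hm : 1 ≤ m) (p : ℕ) {τ W : ℂ} (k b : ℤ)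
    (x : ℤ × ℤ) :
    pairCoeff m p τ (x.1 + b, x.2) * (W * qpow τ ((x.1 + b : ℤ) + 1 / 2)) ^ (2 * m * b + k) =
      qpow τ ((m : ℚ) * ((b : ℚ) + k / (2 * m)) ^ 2) * W ^ (2 * m * b + k) *
        coneTerm m p τ k x := by
  have hm0 : (m : ℚ) ≠ 0 := by positivity
  rw [zpow_mul_qpow, pairCoeff, coneTerm, rowCoeff]
  have h : qpow τ (-(m : ℚ) * (((x.1 + b : ℤ) : ℚ) + 1 / 2) ^ 2) *
      qpow τ (((2 * m * b + k : ℤ) : ℚ) * (((x.1 + b : ℤ) : ℚ) + 1 / 2)) =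
      qpow τ ((m : ℚ) * ((b : ℚ) + k / (2 * m)) ^ 2) *
      qpow τ (-(2 * m * ((x.1 : ℚ) + 1 / 2) - k) ^ 2 / (4 * m)) := by
    rw [← qpow_add, ← qpow_add]
    congr 1
    push_cast
    field_simp
    ring
  linear_combination shiftCoeff m p τ x.2 * W ^ (2 * m * b + k) * h

/-- `coneSum_diag` removes the dependence of the cut on b; this is what lets the sum over b become a
theta function. -/
theorem tsum_fiber {m : ℕ} (hm : 1 ≤ m) (p : ℕ) {τ : ℂ} (hτ : 0 < τ.im) {W : ℂ}
    {k : ℤ} (hk : k ∈ Finset.Ioc (-m : ℤ) m) (b : ℤ) :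
    ∑' x : ℤ × ℤ, pairCoeff m p τ x * (sgnIco (2 * m * x.1) (upperEnd m p x) (2 * m * b + k) *
        (W * qpow τ (x.1 + 1 / 2)) ^ (2 * m * b + k)) =
      qpow τ ((m : ℚ) * ((b : ℚ) + k / (2 * m)) ^ 2) * W ^ (2 * m * b + k) *
        -coneSum m p τ k (rowCut k) 0 := by
  rw [← coneSum_diag hm p hτ k _ ((k - b - p) / (2 * m + 1) + 1), coneSum, ← tsum_neg,
    ← tsum_mul_left, ← ((Equiv.addRight b).prodCongr (Equiv.refl ℤ)).tsum_eq]
  refine tsum_congr fun x => ?_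
  have h1 := pairCoeff_shift (W := W) hm p (τ := τ) k b x
  have h2 := sgnIco_eq_neg_coneWt p hk b x
  simp only [Equiv.prodCongr_apply, Prod.map, Equiv.coe_addRight, Equiv.refl_apply]
  rw [h2]
  linear_combination (-coneWt (rowCut k) ((k - b - p) / (2 * m + 1) + 1) x) * h1

theorem recipSeries_mul_thetaP_eq {m : ℕ} (hm : 1 ≤ m) (p : ℕ) {τ : ℂ} (hτ : 0 < τ.im) {W : ℂ}
    (hW : W ≠ 0) (hW1 : ∀ n : ℤ, 1 - W * qpow τ (n + 1 / 2) ≠ 0) :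
    recipSeries τ W * thetaP m p τ W =
      qpow τ (-(m : ℚ) / 4) * (∑' J, shiftCoeff m p τ J) * appell m τ W +
      ∑ k ∈ Finset.Ioc (-m : ℤ) m, coneSum m p τ k (rowCut k) 0 * thetaInt m k τ W := by
  have hs := summable_triple hm p hτ hW
  have h : Summable fun a : ℤ => ∑' x : ℤ × ℤ, pairCoeff m p τ x *
      (sgnIco (2 * m * x.1) (upperEnd m p x) a * (W * qpow τ (x.1 + 1 / 2)) ^ a) :=
    hs.prod_symm.prod
  have hc : ∑' x : ℤ × ℤ, ∑' a : ℤ, pairCoeff m p τ x *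
      (sgnIco (2 * m * x.1) (upperEnd m p x) a * (W * qpow τ (x.1 + 1 / 2)) ^ a) =
      ∑' a : ℤ, ∑' x : ℤ × ℤ, pairCoeff m p τ x *
      (sgnIco (2 * m * x.1) (upperEnd m p x) a * (W * qpow τ (x.1 + 1 / 2)) ^ a) := hs.tsum_comm.symm
  rw [recipSeries_mul_thetaP hm p hτ hW hW1, hc, tsum_residues hm h, sub_eq_add_neg,
    ← Finset.sum_neg_distrib]
  congr 1
  refine Finset.sum_congr rfl fun k hk => ?_
  rw [tsum_congr (tsum_fiber hm p hτ hk), tsum_mul_right, thetaInt]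
  ring

/-! ### Zwegers' correction term -/

theorem zwegersE_neg (x : ℝ) : zwegersE (-x) = -zwegersE x := by
  have h := intervalIntegral.integral_comp_neg (a := 0) (b := x)
    (fun u : ℝ => Real.exp (-Real.pi * u ^ 2))
  simp only [neg_sq, neg_zero] at h
  rw [zwegersE, zwegersE, intervalIntegral.integral_symm, ← h]
  ring

/-- 1 - E(x) is twice the Gaussian tail beyond x; translate it to (0, ∞) and use (u+x)² ≥ u² + x².
-/
theorem abs_one_sub_zwegersE_le {x : ℝ} (hx : 0 ≤ x) :
    |1 - zwegersE x| ≤ Real.exp (-Real.pi * x ^ 2) := by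
  have hint : MeasureTheory.Integrable fun u : ℝ => Real.exp (-Real.pi * u ^ 2) :=
    integrable_exp_neg_mul_sq Real.pi_pos
  have h0 : ∫ u in Set.Ioi (0 : ℝ), Real.exp (-Real.pi * u ^ 2) = 1 / 2 := by
    rw [integral_gaussian_Ioi, div_self Real.pi_ne_zero, Real.sqrt_one]
  have h1 : (∫ u in (0 : ℝ)..x, Real.exp (-Real.pi * u ^ 2)) +
      ∫ u in Set.Ioi x, Real.exp (-Real.pi * u ^ 2) = 1 / 2 := by
    rw [← h0]
    exact intervalIntegral.integral_interval_add_Ioi hint.integrableOn hint.integrableOn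
  have h2 : 1 - zwegersE x = 2 * ∫ u in Set.Ioi x, Real.exp (-Real.pi * u ^ 2) := by
    rw [zwegersE]; linarith
  have h3 : ∫ u in Set.Ioi x, Real.exp (-Real.pi * u ^ 2) =
      ∫ u in Set.Ioi (0 : ℝ), Real.exp (-Real.pi * (u + x) ^ 2) := by
    rw [← (MeasureTheory.measurePreserving_add_right MeasureTheory.volume x).setIntegral_preimage_emb
      (measurableEmbedding_addRight x), Set.preimage_add_const_Ioi, sub_self]
  have h4 : ∫ u in Set.Ioi (0 : ℝ), Real.exp (-Real.pi * (u + x) ^ 2) ≤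
      ∫ u in Set.Ioi (0 : ℝ), Real.exp (-Real.pi * x ^ 2) * Real.exp (-Real.pi * u ^ 2) := by
    refine MeasureTheory.setIntegral_mono_on (hint.comp_add_right x).integrableOn
      (hint.const_mul _).integrableOn measurableSet_Ioi fun u hu => ?_
    rw [← Real.exp_add]
    apply Real.exp_le_exp.mpr
    have := mul_nonneg (mul_nonneg Real.pi_pos.le (le_of_lt hu)) hx
    nlinarith
  rw [MeasureTheory.integral_const_mul, h0] at h4
  have h5 : 0 ≤ ∫ u in Set.Ioi x, Real.exp (-Real.pi * u ^ 2) :=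
    MeasureTheory.integral_nonneg fun _ => (Real.exp_pos _).le
  rw [h2, abs_of_nonneg (by linarith), h3]
  linarith

theorem abs_neg_one_sub_zwegersE_le {x : ℝ} (hx : x ≤ 0) :
    |-1 - zwegersE x| ≤ Real.exp (-Real.pi * x ^ 2) := by
  have := abs_one_sub_zwegersE_le (neg_nonneg.mpr hx)
  rw [zwegersE_neg, neg_sq] at this
  rw [← abs_neg]
  convert this using 2
  ring

/-- The sign occurring in the `l`-th term of `zwegersR`. -/
noncomputable def sgnR (l : ℤ) : ℝ := if 0 ≤ l then 1 else -1

/-- The argument is 2m(l+1) - ½; the -½ makes l = -1 negative. -/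
theorem sign_eq_sgnR {m : ℕ} (hm : 1 ≤ m) (j l : ℤ) :
    Real.sign (((j + 2 * m * l : ℤ) : ℝ) - 1 / 2 - j + 2 * m) = sgnR l := by
  have hm' : (1 : ℝ) ≤ m := by exact_mod_cast hm
  rw [sgnR]
  split_ifs with h
  · have : (0 : ℝ) ≤ l := by exact_mod_cast h
    apply Real.sign_of_pos
    push_cast
    nlinarith
  · have : (l : ℝ) ≤ -1 := by exact_mod_cast (by omega : l ≤ -1)
    apply Real.sign_of_neg
    push_cast
    nlinarith

/-- The `l`-th term of `zwegersR j m τ (τ / 2)`, up to the factor `q ^ (m / 4)`. -/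
noncomputable def errTerm (m : ℕ) (τ : ℂ) (j l : ℤ) : ℂ :=
  ((sgnR l - zwegersE (((j + 2 * m * l - m : ℤ) : ℝ) * √(τ.im / m)) : ℝ) : ℂ) *
    qpow τ (-((j + 2 * m * l - m : ℤ) : ℚ) ^ 2 / (4 * m))

/-- The Gaussian bound on sgn - E beats the growth of the q-power, leaving the norm of
q^{(j+2ml-m)²/(4m)}. -/
theorem summable_errTerm {m : ℕ} (hm : 1 ≤ m) {τ : ℂ} (hτ : 0 < τ.im) {j : ℤ} (h0 : 0 ≤ j)
    (h1 : j ≤ 2 * m) : Summable (errTerm m τ j) := by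
  have hm' : (0 : ℝ) < m := by exact_mod_cast hm
  have hs := summable_norm_of_one_add_abs_mul (summable_qpow_mul_zpow hτ one_ne_zero
    (a := (m : ℚ)) (by exact_mod_cast hm) (j - m : ℚ) ((j - m) ^ 2 / (4 * m)) 0 0)
  rw [← summable_norm_iff]
  -- For l = 0 the sign of j-m need not agree with `sgnR`; for l ≠ 0 it does, because 0 ≤ j ≤ 2m.
  refine (Finset.summable_compl_iff {(0 : ℤ)}).mp ?_
  refine Summable.of_nonneg_of_le (fun _ => norm_nonneg _) (fun l => ?_)
    (hs.subtype _)
  obtain ⟨l, hl⟩ := l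
  have hl : l ≠ 0 := by simpa using hl
  have hx : |sgnR l - zwegersE (((j + 2 * m * l - m : ℤ) : ℝ) * √(τ.im / m))| ≤
      Real.exp (-Real.pi * (((j + 2 * m * l - m : ℤ) : ℝ) * √(τ.im / m)) ^ 2) := by
    rw [sgnR]
    split_ifs with h
    · apply abs_one_sub_zwegersE_le
      have : 0 ≤ j + 2 * m * l - m := by
        have : 1 ≤ l := by omega
        nlinarith
      have : (0 : ℝ) ≤ ((j + 2 * m * l - m : ℤ) : ℝ) := by exact_mod_cast this
      positivity
    · apply abs_neg_one_sub_zwegersE_le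
      have : j + 2 * m * l - m ≤ 0 := by
        have : l ≤ -1 := by omega
        nlinarith
      have : ((j + 2 * m * l - m : ℤ) : ℝ) ≤ 0 := by exact_mod_cast this
      exact mul_nonpos_of_nonpos_of_nonneg this (Real.sqrt_nonneg _)
  rw [errTerm, norm_mul, Complex.norm_real, Real.norm_eq_abs]
  refine (mul_le_mul_of_nonneg_right hx (norm_nonneg _)).trans (le_of_eq ?_)
  simp only [Function.comp, one_zpow, mul_one]
  rw [norm_qpow, norm_qpow, ← Real.exp_add, mul_pow, Real.sq_sqrt (by positivity)]
  congr 1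
  push_cast
  field_simp
  ring

/-- The reflection negates j+2ml-m, so the odd function E cancels. The signs cancel too, except at l
= 0, where both are +1. -/
theorem errTerm_reflect (m : ℕ) (τ : ℂ) (j l : ℤ) :
    errTerm m τ j l + errTerm m τ (2 * m - j) (-l) =
      if l = 0 then 2 * qpow τ (-((m : ℚ) - j) ^ 2 / (4 * m)) else 0 := by
  have e : 2 * m - j + 2 * m * (-l) - m = -(j + 2 * m * l - m) := by ring
  rw [errTerm, errTerm, e, Int.cast_neg, Int.cast_neg, neg_mul, zwegersE_neg, neg_sq, ← add_mul]
  split_ifs with h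
  · subst h
    simp only [sgnR, neg_zero, le_refl, if_true]
    congr 1
    · push_cast; ring
    · congr 1; push_cast; ring
  · rcases lt_or_gt_of_ne h with h | h
    · rw [sgnR, sgnR, if_neg (by omega), if_pos (by omega)]
      push_cast; ring
    · rw [sgnR, sgnR, if_pos (by omega), if_neg (by omega)]
      push_cast; ring

theorem tsum_errTerm_add {m : ℕ} (hm : 1 ≤ m) {τ : ℂ} (hτ : 0 < τ.im) {j : ℤ} (h0 : 0 ≤ j)
    (h1 : j ≤ 2 * m) : (∑' l, errTerm m τ j l) + ∑' l, errTerm m τ (2 * m - j) l =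
      2 * qpow τ (-((m : ℚ) - j) ^ 2 / (4 * m)) := by
  have s1 := summable_errTerm hm hτ h0 h1
  have s2 := summable_errTerm hm hτ (j := 2 * m - j) (by omega) (by omega)
  have s3 : Summable fun l => errTerm m τ (2 * m - j) (Equiv.neg ℤ l) :=
    (Equiv.neg ℤ).summable_iff.mpr s2
  rw [← (Equiv.neg ℤ).tsum_eq (errTerm m τ (2 * m - j)), ← s1.tsum_add s3]
  simp_rw [Equiv.neg_apply, errTerm_reflect]
  rw [tsum_ite_eq]

/-- The partner 2m of j = 0 lies outside [0, 2m). Shifting l by one identifies the classes of 0 and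
2m up to a single sign, so both the sum and the difference of the two series are known. -/
theorem tsum_errTerm_zero {m : ℕ} (hm : 1 ≤ m) {τ : ℂ} (hτ : 0 < τ.im) :
    ∑' l, errTerm m τ 0 l = 2 * qpow τ (-(m : ℚ) ^ 2 / (4 * m)) := by
  have s1 := summable_errTerm hm hτ (j := 0) le_rfl (by omega)
  have s2 := summable_errTerm hm hτ (j := 2 * m) (by omega) le_rfl
  have h1 := tsum_errTerm_add hm hτ (j := 0) le_rfl (by omega)
  have h2 : (∑' l, errTerm m τ 0 l) - ∑' l, errTerm m τ (2 * m) l =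
      2 * qpow τ (-(m : ℚ) ^ 2 / (4 * m)) := by
    have s3 : Summable fun l => errTerm m τ (2 * m) (Equiv.subRight (1 : ℤ) l) :=
      (Equiv.subRight (1 : ℤ)).summable_iff.mpr s2
    rw [← (Equiv.subRight (1 : ℤ)).tsum_eq (errTerm m τ (2 * m)), ← s1.tsum_sub s3,
      ← tsum_ite_eq (0 : ℤ) fun _ => 2 * qpow τ (-(m : ℚ) ^ 2 / (4 * m))]
    refine tsum_congr fun l => ?_
    have e : 2 * m + 2 * m * (l - 1) - m = 0 + 2 * m * l - m := by ring
    rw [Equiv.subRight_apply, errTerm, errTerm, e, ← sub_mul]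
    split_ifs with h
    · subst h
      rw [sgnR, sgnR, if_pos (by omega), if_neg (by omega)]
      congr 1
      · push_cast; ring
      · congr 1; push_cast; ring
    · have : sgnR (l - 1) = sgnR l := by
        rw [sgnR, sgnR]; split_ifs <;> first | omega | rfl
      rw [this]; ring
  simp only [sub_zero, Int.cast_zero] at h1
  linear_combination (1 / 2 : ℂ) * h1 + (1 / 2 : ℂ) * h2

/-- With Im v = Im τ/2 the argument of E is centred at n = m, and n/2 - n²/(4m) = m/4 - (n-m)²/(4m).
As ε² = 1, the factor ε^n depends only on j. -/
theorem zwegersR_eq {m : ℕ} (hm : 1 ≤ m) {τ : ℂ} (hτ : 0 < τ.im) (j : ℤ) {v ε : ℂ}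
    (hv : v.im = τ.im / 2) (hε : ε ^ 2 = 1)
    (hvε : Complex.exp (2 * Real.pi * Complex.I * v) = ε * qpow τ (1 / 2)) :
    zwegersR j m τ v = ε ^ j * qpow τ ((m : ℚ) / 4) * ∑' l, errTerm m τ j l := by
  have hm' : (m : ℚ) ≠ 0 := by positivity
  have hmC : (m : ℂ) ≠ 0 := by exact_mod_cast hm'
  have hε0 : ε ≠ 0 := by rintro rfl; simp at hε
  rw [zwegersR, ← tsum_mul_left]
  refine tsum_congr fun l => ?_
  rw [sign_eq_sgnR hm, errTerm]
  have e1 : ((j + 2 * m * l : ℤ) : ℝ) - 2 * m * v.im / τ.im = ((j + 2 * m * l - m : ℤ) : ℝ) := by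
    rw [hv]
    have := hτ.ne'
    push_cast
    field_simp
  have e2 : Complex.exp (-Real.pi * Complex.I * ((j + 2 * m * l : ℤ) : ℂ) ^ 2 * τ / (2 * m)
        + 2 * Real.pi * Complex.I * ((j + 2 * m * l : ℤ) : ℂ) * v) =
      ε ^ j * qpow τ ((m : ℚ) / 4) * qpow τ (-((j + 2 * m * l - m : ℤ) : ℚ) ^ 2 / (4 * m)) := by
    have e3 : 2 * Real.pi * Complex.I * ((j + 2 * m * l : ℤ) : ℂ) * v =
        ((j + 2 * m * l : ℤ) : ℂ) * (2 * Real.pi * Complex.I * v) := by ring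
    have e4 : ε ^ (j + 2 * m * l) = ε ^ j := by
      rw [zpow_add₀ hε0, mul_assoc, zpow_mul, show ε ^ (2 : ℤ) = 1 by exact_mod_cast hε, one_zpow,
        mul_one]
    have e5 : Complex.exp (-Real.pi * Complex.I * ((j + 2 * m * l : ℤ) : ℂ) ^ 2 * τ / (2 * m)) =
        qpow τ (-((j + 2 * m * l : ℤ) : ℚ) ^ 2 / (4 * m)) := by
      rw [qpow]
      congr 1
      push_cast
      field_simp
      ring
    rw [Complex.exp_add, e3, Complex.exp_int_mul, hvε, mul_zpow, e4, e5, qpow_zpow, mul_left_comm,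
      ← qpow_add, mul_assoc (ε ^ j), ← qpow_add]
    congr 2
    push_cast
    field_simp
    ring
  rw [e1, e2]
  ring

/-! ### Theta functions and Φ̃ in the variable W -/

theorem exp_pi_mul_zpow (z : ℂ) (N : ℤ) : Complex.exp (Real.pi * Complex.I * z) ^ N =
    Complex.exp (Real.pi * Complex.I * N * z) := by
  rw [← Complex.exp_int_mul]; congr 1; ring

theorem zpow_of_sq_eq_one {c : ℂ} (hc : c ^ 2 = 1) {a b : ℤ} (h : Even (a - b)) : c ^ a = c ^ b := by
  have hc0 : c ≠ 0 := by rintro rfl; simp at hc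
  obtain ⟨d, hd⟩ := h
  rw [← sub_add_cancel a b, hd, zpow_add₀ hc0, ← two_mul, zpow_mul, zpow_ofNat, hc, one_zpow,
    one_mul]

theorem thetaInt_inv (m : ℕ) (k : ℤ) (τ W : ℂ) : thetaInt m k τ W⁻¹ = thetaInt m (-k) τ W := by
  rw [thetaInt, thetaInt, ← (Equiv.neg ℤ).tsum_eq]
  refine tsum_congr fun b => ?_
  rw [Equiv.neg_apply, inv_zpow']
  congr 2
  · push_cast; ring
  · ring

theorem thetaInt_add_two_mul {m : ℕ} (hm : 1 ≤ m) (k : ℤ) (τ W : ℂ) :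
    thetaInt m (k + 2 * m) τ W = thetaInt m k τ W := by
  have hm0 : (m : ℚ) ≠ 0 := by positivity
  rw [thetaInt, thetaInt, ← (Equiv.addRight (1 : ℤ)).tsum_eq fun b : ℤ =>
    qpow τ ((m : ℚ) * ((b : ℚ) + k / (2 * m)) ^ 2) * W ^ (2 * m * b + k)]
  refine tsum_congr fun b => ?_
  rw [Equiv.coe_addRight]
  congr 2
  · push_cast
    field_simp
    ring
  · ring

theorem zpow_mul_theta {m : ℕ} (hm : 1 ≤ m) (k : ℤ) (τ z : ℂ) {c W : ℂ} (hc : c ^ 2 = 1)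
    (hW : W = c * Complex.exp (Real.pi * Complex.I * z)) :
    c ^ k * theta (k : ℚ) m τ z = thetaInt m k τ W := by
  have hm0 : (m : ℂ) ≠ 0 := by simp; omega
  rw [theta, thetaInt, ← tsum_mul_left]
  refine tsum_congr fun b => ?_
  rw [hW, mul_zpow, exp_pi_mul_zpow, zpow_of_sq_eq_one hc (a := 2 * m * b + k) (b := k)
    ⟨m * b, by ring⟩]
  have : 2 * (Real.pi : ℂ) * Complex.I * (((m : ℚ) * ((b : ℚ) + k / (2 * m)) : ℚ) : ℂ) * z =
      Real.pi * Complex.I * ((2 * m * b + k : ℤ) : ℂ) * z := by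
    push_cast
    field_simp
  rw [this]
  ring

/-- `θ_{k,m} + θ_{-k,m}` in the variable `W`. -/
noncomputable def thetaSym (m : ℕ) (k : ℤ) (τ W : ℂ) : ℂ := thetaInt m k τ W + thetaInt m (-k) τ W

theorem thetaSym_neg (m : ℕ) (k : ℤ) (τ W : ℂ) : thetaSym m (-k) τ W = thetaSym m k τ W := by
  rw [thetaSym, thetaSym, neg_neg, add_comm]

theorem thetaSym_two_mul_sub {m : ℕ} (hm : 1 ≤ m) (k : ℤ) (τ W : ℂ) :
    thetaSym m (2 * m - k) τ W = thetaSym m k τ W := by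
  have h := thetaInt_add_two_mul hm (k - 2 * m) τ W
  rw [sub_add_cancel] at h
  rw [thetaSym, thetaSym, neg_sub, ← h, sub_eq_neg_add, thetaInt_add_two_mul hm, add_comm]

theorem zpow_mul_theta_add {m : ℕ} (hm : 1 ≤ m) (k : ℤ) (τ z : ℂ) {c W : ℂ} (hc : c ^ 2 = 1)
    (hW : W = c * Complex.exp (Real.pi * Complex.I * z)) :
    c ^ k * (theta (k : ℚ) m τ z + theta (-(k : ℚ)) m τ z) = thetaSym m k τ W := by
  rw [thetaSym, ← zpow_mul_theta hm k τ z hc hW, ← zpow_mul_theta hm (-k) τ z hc hW,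
    zpow_of_sq_eq_one hc (a := -k) (b := k) ⟨-k, by ring⟩]
  push_cast
  ring

theorem rowCoeff_zero (m : ℕ) (τ : ℂ) (k : ℤ) :
    rowCoeff m τ k 0 = qpow τ (-((m : ℚ) - k) ^ 2 / (4 * m)) := by
  rw [rowCoeff]; congr 1; push_cast; ring

theorem sum_Ico_one_two_mul {m : ℕ} (hm : 1 ≤ m) {f : ℤ → ℂ} (hf : ∀ k, f (2 * m - k) = f k) :
    ∑ k ∈ Finset.Ico (1 : ℤ) (2 * m), f k = 2 * ∑ k ∈ Finset.Ioo (0 : ℤ) m, f k + f m := by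
  have h1 : Finset.Ico (1 : ℤ) (2 * m) =
      Finset.Ioo (0 : ℤ) m ∪ insert (m : ℤ) (Finset.Ioo (m : ℤ) (2 * m)) := by
    ext k; simp only [Finset.mem_Ico, Finset.mem_union, Finset.mem_Ioo, Finset.mem_insert]; omega
  have h2 : ∑ k ∈ Finset.Ioo (m : ℤ) (2 * m), f k = ∑ k ∈ Finset.Ioo (0 : ℤ) m, f k := by
    refine Finset.sum_nbij' (fun k => 2 * m - k) (fun k => 2 * m - k) ?_ ?_ ?_ ?_ ?_
    · intro k hk; simp only [Finset.mem_Ioo] at hk ⊢; omega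
    · intro k hk; simp only [Finset.mem_Ioo] at hk ⊢; omega
    · intro k _; ring
    · intro k _; ring
    · intro k _; exact (hf k).symm
  rw [h1, Finset.sum_union, Finset.sum_insert (by simp), h2]
  · ring
  · rw [Finset.disjoint_left]
    intro k hk
    simp only [Finset.mem_Ioo, Finset.mem_insert] at hk ⊢
    omega

/-- Averaging over j ↔ 2m-j replaces each error series by a single `rowCoeff`; j = 0 is treated
apart, and j = m is its own partner, so it enters once. -/
theorem sum_errTerm_mul {m : ℕ} (hm : 1 ≤ m) {τ : ℂ} (hτ : 0 < τ.im) {t : ℤ → ℂ}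
    (ht : ∀ k, t (2 * m - k) = t k) :
    ∑ j ∈ Finset.Ico (0 : ℤ) (0 + 2 * m), (∑' l, errTerm m τ j l) * t j =
      2 * (rowCoeff m τ 0 0 * t 0 + ∑ j ∈ Finset.Ioo (0 : ℤ) m, rowCoeff m τ j 0 * t j) + t m := by
  have h1 : Finset.Ico (0 : ℤ) (0 + 2 * m) = insert 0 (Finset.Ico (1 : ℤ) (2 * m)) := by
    ext k; simp only [Finset.mem_Ico, Finset.mem_insert]; omega
  have h2 : ∑ j ∈ Finset.Ico (1 : ℤ) (2 * m), (∑' l, errTerm m τ (2 * m - j) l) * t j =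
      ∑ j ∈ Finset.Ico (1 : ℤ) (2 * m), (∑' l, errTerm m τ j l) * t j := by
    refine Finset.sum_nbij' (fun k => 2 * m - k) (fun k => 2 * m - k) ?_ ?_ ?_ ?_ ?_
    · intro k hk; simp only [Finset.mem_Ico] at hk ⊢; omega
    · intro k hk; simp only [Finset.mem_Ico] at hk ⊢; omega
    · intro k _; ring
    · intro k _; ring
    · intro k _; rw [ht]
  have h3 : ∑ j ∈ Finset.Ico (1 : ℤ) (2 * m), ((∑' l, errTerm m τ j l) * t j +
      (∑' l, errTerm m τ (2 * m - j) l) * t j) =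
      ∑ j ∈ Finset.Ico (1 : ℤ) (2 * m), 2 * (rowCoeff m τ j 0 * t j) := by
    refine Finset.sum_congr rfl fun j hj => ?_
    rw [Finset.mem_Ico] at hj
    rw [← add_mul, tsum_errTerm_add hm hτ (by omega) (by omega), rowCoeff_zero]
    ring
  rw [Finset.sum_add_distrib, h2, ← Finset.mul_sum, sum_Ico_one_two_mul hm
    (f := fun j => rowCoeff m τ j 0 * t j)] at h3
  · have h4 : rowCoeff m τ m 0 = 1 := by
      rw [rowCoeff_zero, Int.cast_natCast, sub_self]; simp [qpow_zero]
    rw [h4] at h3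
    rw [h1, Finset.sum_insert (by simp), tsum_errTerm_zero hm hτ, rowCoeff_zero, Int.cast_zero,
      sub_zero]
    linear_combination (1 / 2 : ℂ) * h3
  · intro k
    rw [ht, rowCoeff_zero, rowCoeff_zero]
    congr 2
    push_cast
    ring

/-- The twist c^j in R is absorbed by passing from z to W, since c² = 1. All error functions are
then gone. -/
theorem PhiStarAdd_eq {m : ℕ} (hm : 1 ≤ m) {τ : ℂ} (hτ : 0 < τ.im) {z z₁ z₂ c W : ℂ} (hc : c ^ 2 = 1)
    (hW : W = c * Complex.exp (Real.pi * Complex.I * z)) (h1 : z₁ + z₂ = z)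
    (him : ((z₁ - z₂) / 2).im = τ.im / 2)
    (hexp : Complex.exp (2 * Real.pi * Complex.I * ((z₁ - z₂) / 2)) = c * qpow τ (1 / 2)) :
    PhiStarAdd m 0 τ z₁ z₂ 0 = -qpow τ ((m : ℚ) / 4) *
      (rowCoeff m τ 0 0 * thetaSym m 0 τ W +
        ∑ j ∈ Finset.Ioo (0 : ℤ) m, rowCoeff m τ j 0 * thetaSym m j τ W +
        1 / 2 * thetaSym m m τ W) := by
  have h2 : PhiStarAdd m 0 τ z₁ z₂ 0 = -(1 / 2) * qpow τ ((m : ℚ) / 4) *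
      ∑ j ∈ Finset.Ico (0 : ℤ) (0 + 2 * m), (∑' l, errTerm m τ j l) * thetaSym m j τ W := by
    rw [PhiStarAdd, Phi1Add, Phi2Add, mul_zero, Complex.exp_zero, mul_one, ← mul_add,
      ← Finset.sum_add_distrib, mul_assoc, Finset.mul_sum, Finset.mul_sum, Finset.mul_sum]
    refine Finset.sum_congr rfl fun j _ => ?_
    rw [zwegersR_eq hm hτ j him hc hexp, ← zpow_mul_theta_add hm j τ z hc hW, h1]
    ring
  rw [h2, sum_errTerm_mul hm hτ fun k => thetaSym_two_mul_sub hm k τ W]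
  ring

/-- The poles of Φ₂ are those of Φ₁ with W inverted. -/
theorem PhiStar_eq {m : ℕ} {τ z z₁ z₂ W : ℂ}
    (hW : W ^ 2 = Complex.exp (2 * Real.pi * Complex.I * z)) (h1 : z₁ + z₂ = z)
    (hz₁ : Complex.exp (2 * Real.pi * Complex.I * z₁) = W * qpow τ (1 / 2))
    (hz₂ : Complex.exp (-2 * Real.pi * Complex.I * z₂) = W⁻¹ * qpow τ (1 / 2)) :
    PhiStar m 0 τ z₁ z₂ 0 = appell m τ W + appell m τ W⁻¹ := by
  have hz : ∀ n : ℤ, W ^ (2 * m * n) = Complex.exp (2 * Real.pi * Complex.I * m * n * z) := by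
    intro n
    rw [mul_assoc, zpow_mul, zpow_ofNat, hW, ← Complex.exp_int_mul]
    congr 1; push_cast; ring
  rw [PhiStar, Phi1, Phi2, mul_zero, Complex.exp_zero, one_mul, one_mul, appell, appell]
  congr 1
  · refine tsum_congr fun n => ?_
    rw [hz₁, h1, hz, mul_assoc W, ← qpow_add, add_comm (1 / 2 : ℚ)]
    simp only [Int.cast_zero, zero_mul, mul_zero, add_zero]
  · refine tsum_congr fun n => ?_
    rw [hz₂, h1, inv_zpow', ← mul_neg, hz, mul_assoc W⁻¹, ← qpow_add, add_comm (1 / 2 : ℚ)]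
    congr 2
    congr 2
    · push_cast; ring_nf
    · simp

/-! ### The cones in A and B -/

/-- The general term of the indefinite double series, without theta functions. -/
noncomputable def regionTerm (m p : ℕ) (τ : ℂ) (k : ℤ) (x : ℤ × ℤ) : ℂ :=
  (-1 : ℂ) ^ x.1 * qpow τ (((m : ℚ) + 1 / 2) * (halfOdd x.1 + 2 * p * m / (2 * m + 1)) ^ 2) *
    qpow τ (-(2 * m * halfOdd x.2 - k + 2 * m * p) ^ 2 / (4 * m))

/-- The change of coordinates `(r, J) ↦ (-J - p, r - p)`. -/
def coneEquiv (p : ℕ) : ℤ × ℤ ≃ ℤ × ℤ where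
  toFun y := (-y.2 - p, y.1 - p)
  invFun x := (x.2 + p, -x.1 - p)
  left_inv y := by ext <;> simp
  right_inv x := by ext <;> simp

theorem regionTerm_coneEquiv (m p : ℕ) (τ : ℂ) (k : ℤ) (y : ℤ × ℤ) :
    regionTerm m p τ k (coneEquiv p y) = (-1) ^ p * coneTerm m p τ k y := by
  have hm1 : (2 * (m : ℚ) + 1) ≠ 0 := by positivity
  simp only [regionTerm, coneEquiv, Equiv.coe_fn_mk, coneTerm, shiftCoeff, rowCoeff, halfOdd]
  rw [neg_one_zpow_congr (a := -y.2 - p) (b := p + y.2) ⟨-y.2 - p, by ring⟩,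
    zpow_add₀ (by norm_num), zpow_natCast]
  have e1 : ((m : ℚ) + 1 / 2) * (((-y.2 - p : ℤ) : ℚ) + 1 / 2 + 2 * p * m / (2 * m + 1)) ^ 2 =
      ((m : ℚ) + 1 / 2) * (y.2 - 1 / 2 + p / (2 * m + 1)) ^ 2 := by
    push_cast
    field_simp
    ring
  have e2 : -(2 * m * (((y.1 - p : ℤ) : ℚ) + 1 / 2) - k + 2 * m * p) ^ 2 / (4 * (m : ℚ)) =
      -(2 * m * ((y.1 : ℚ) + 1 / 2) - k) ^ 2 / (4 * m) := by
    push_cast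
    ring
  rw [e1, e2]
  ring

theorem summable_indicator_regionTerm {m : ℕ} (hm : 1 ≤ m) (p : ℕ) {τ : ℂ} (hτ : 0 < τ.im) (k : ℤ)
    {S : Set (ℤ × ℤ)} {C : ℕ} (hS : ∀ x ∈ S, (x.2 + p).natAbs ≤ (x.1 + p).natAbs + C) :
    Summable (S.indicator (regionTerm m p τ k)) := by
  rw [← (coneEquiv p).summable_iff]
  have h := summable_indicator_coneTerm hm p hτ k (R := coneEquiv p ⁻¹' S) (C := C) fun y hy => by
    have := hS _ hy
    simp only [coneEquiv, Equiv.coe_fn_mk] at this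
    omega
  refine (h.mul_left ((-1) ^ p)).congr fun y => ?_
  rw [Function.comp]
  by_cases hy : coneEquiv p y ∈ S
  · rw [Set.indicator_of_mem hy, Set.indicator_of_mem (Set.mem_preimage.mpr hy),
      regionTerm_coneEquiv]
  · rw [Set.indicator_of_notMem hy, Set.indicator_of_notMem (by simpa using hy), mul_zero]

theorem halfOdd_nonneg (a : ℤ) : 0 ≤ halfOdd a ↔ 0 ≤ a := by
  rw [halfOdd]
  constructor
  · intro h
    by_contra hc
    have : (a : ℚ) ≤ -1 := by exact_mod_cast (by omega : a ≤ -1)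
    linarith
  · intro h
    have : (0 : ℚ) ≤ a := by exact_mod_cast h
    linarith

theorem halfOdd_neg (a : ℤ) : halfOdd a < 0 ↔ a < 0 := by
  rw [← not_le, halfOdd_nonneg, not_le]

theorem halfOdd_le (a b : ℤ) : halfOdd a ≤ halfOdd b ↔ a ≤ b := by
  simp [halfOdd]

theorem halfOdd_lt (a b : ℤ) : halfOdd a < halfOdd b ↔ a < b := by
  simp [halfOdd]

theorem mem_conePosLt (x : ℤ × ℤ) : x ∈ conePosLt ↔ 0 ≤ x.2 ∧ x.2 < x.1 := by
  rw [← halfOdd_nonneg, ← halfOdd_lt]; rfl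

theorem mem_conePosLe (x : ℤ × ℤ) : x ∈ conePosLe ↔ 0 ≤ x.2 ∧ x.2 ≤ x.1 := by
  rw [← halfOdd_nonneg, ← halfOdd_le]; rfl

theorem mem_coneNegLt (x : ℤ × ℤ) : x ∈ coneNegLt ↔ x.1 < x.2 ∧ x.2 < 0 := by
  rw [← halfOdd_neg, ← halfOdd_lt]; rfl

theorem mem_coneNegLe (x : ℤ × ℤ) : x ∈ coneNegLe ↔ x.1 ≤ x.2 ∧ x.2 < 0 := by
  rw [← halfOdd_neg, ← halfOdd_le]; rfl

theorem summable_conePosLt {m : ℕ} (hm : 1 ≤ m) (p : ℕ) {τ : ℂ} (hτ : 0 < τ.im)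
    (k : ℤ) : Summable (conePosLt.indicator (regionTerm m p τ k)) :=
  summable_indicator_regionTerm hm p hτ k (C := 2 * p) fun x hx => by
    rw [mem_conePosLt] at hx; omega

theorem summable_conePosLe {m : ℕ} (hm : 1 ≤ m) (p : ℕ) {τ : ℂ} (hτ : 0 < τ.im)
    (k : ℤ) : Summable (conePosLe.indicator (regionTerm m p τ k)) :=
  summable_indicator_regionTerm hm p hτ k (C := 2 * p) fun x hx => by
    rw [mem_conePosLe] at hx; omega

theorem summable_coneNegLt {m : ℕ} (hm : 1 ≤ m) (p : ℕ) {τ : ℂ} (hτ : 0 < τ.im)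
    (k : ℤ) : Summable (coneNegLt.indicator (regionTerm m p τ k)) :=
  summable_indicator_regionTerm hm p hτ k (C := 2 * p) fun x hx => by
    rw [mem_coneNegLt] at hx; omega

theorem summable_coneNegLe {m : ℕ} (hm : 1 ≤ m) (p : ℕ) {τ : ℂ} (hτ : 0 < τ.im)
    (k : ℤ) : Summable (coneNegLe.indicator (regionTerm m p τ k)) :=
  summable_indicator_regionTerm hm p hτ k (C := 2 * p) fun x hx => by
    rw [mem_coneNegLe] at hx; omega

/-- In the coordinates (r, J) the two regions are the two halves of one double cone, with row cut p
and antidiagonal cut c. -/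
theorem tsum_cone_sub {m : ℕ} (p : ℕ) {τ : ℂ} (k : ℤ) {S T : Set (ℤ × ℤ)} {c : ℤ}
    (hS : Summable (S.indicator (regionTerm m p τ k)))
    (hT : Summable (T.indicator (regionTerm m p τ k)))
    (hwS : ∀ y, coneEquiv p y ∈ S ↔ (p : ℤ) ≤ y.1 ∧ y.2 + y.1 < c)
    (hwT : ∀ y, coneEquiv p y ∈ T ↔ y.1 < (p : ℤ) ∧ c ≤ y.2 + y.1) :
    (∑' x : S, regionTerm m p τ k x) - ∑' x : T, regionTerm m p τ k x =
      (-1) ^ p * coneSum m p τ k p c := by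
  rw [tsum_subtype, tsum_subtype, ← hS.tsum_sub hT, ← (coneEquiv p).tsum_eq, coneSum,
    ← tsum_mul_left]
  refine tsum_congr fun y => ?_
  have h1 := hwS y
  have h2 := hwT y
  have h3 := regionTerm_coneEquiv m p τ k y
  rw [coneWt, Set.indicator, Set.indicator, h3]
  split_ifs <;> grind

theorem tsum_coneB {m : ℕ} (hm : 1 ≤ m) (p : ℕ) {τ : ℂ} (hτ : 0 < τ.im)
    (k : ℤ) :
    (∑' x : conePosLe, regionTerm m p τ k x) - ∑' x : coneNegLt, regionTerm m p τ k x =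
      (-1) ^ p * coneSum m p τ k p 1 := by
  refine tsum_cone_sub p k (summable_conePosLe hm p hτ k) (summable_coneNegLt hm p hτ k)
    (fun y => ?_) fun y => ?_
  · rw [mem_conePosLe]; simp only [coneEquiv, Equiv.coe_fn_mk]; omega
  · rw [mem_coneNegLt]; simp only [coneEquiv, Equiv.coe_fn_mk]; omega

/-- The antidiagonal cut is 0 for A and 1 for B; this records strict against weak inequality between
r and j. -/
theorem tsum_coneA {m : ℕ} (hm : 1 ≤ m) (p : ℕ) {τ : ℂ} (hτ : 0 < τ.im)
    (k : ℤ) :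
    (∑' x : conePosLt, regionTerm m p τ k x) - ∑' x : coneNegLe, regionTerm m p τ k x =
      (-1) ^ p * coneSum m p τ k p 0 := by
  refine tsum_cone_sub p k (summable_conePosLt hm p hτ k) (summable_coneNegLe hm p hτ k)
    (fun y => ?_) fun y => ?_
  · rw [mem_conePosLt]; simp only [coneEquiv, Equiv.coe_fn_mk]; omega
  · rw [mem_coneNegLe]; simp only [coneEquiv, Equiv.coe_fn_mk]; omega

/-! ### Symmetrisation in W and the finite sums -/

theorem one_sub_inv_mul_qpow_ne_zero {τ W : ℂ} (hW : W ≠ 0)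
    (hW1 : ∀ n : ℤ, 1 - W * qpow τ (n + 1 / 2) ≠ 0) (n : ℤ) :
    1 - W⁻¹ * qpow τ (n + 1 / 2) ≠ 0 := by
  intro h
  apply hW1 (-n - 1)
  have h1 : W = qpow τ (n + 1 / 2) := by
    rw [sub_eq_zero, ← div_eq_inv_mul, eq_comm, div_eq_one_iff_eq hW] at h
    exact h.symm
  rw [h1, ← qpow_add, sub_eq_zero, ← qpow_zero τ]
  congr 1
  push_cast
  ring

/-- Sum of the identities at W and W⁻¹, which share the even denominator `thetaOdd`. It is nonzero
because its product with `recipSeries` is η³ ≠ 0. -/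
theorem eta_div_thetaOdd_mul {m : ℕ} (hm : 1 ≤ m) (p : ℕ) {τ : ℂ} (hτ : 0 < τ.im) {W : ℂ}
    (hW : W ≠ 0) (hW1 : ∀ n : ℤ, 1 - W * qpow τ (n + 1 / 2) ≠ 0) :
    ModularForm.eta τ ^ 3 / thetaOdd τ W * (thetaP m p τ W + thetaP m p τ W⁻¹) =
      qpow τ (-(m : ℚ) / 4) * (∑' J, shiftCoeff m p τ J) * (appell m τ W + appell m τ W⁻¹) +
      ∑ k ∈ Finset.Ioc (-m : ℤ) m, coneSum m p τ k (rowCut k) 0 * thetaSym m k τ W := by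
  have hW' := one_sub_inv_mul_qpow_ne_zero hW hW1
  have hη : ModularForm.eta τ ^ 3 ≠ 0 := pow_ne_zero _ (ModularForm.eta_ne_zero hτ)
  have key : ∀ V : ℂ, V ≠ 0 → (∀ n : ℤ, 1 - V * qpow τ (n + 1 / 2) ≠ 0) →
      ModularForm.eta τ ^ 3 / thetaOdd τ V = recipSeries τ V := by
    intro V hV hV1
    have h := recipSeries_mul_thetaOdd hτ hV hV1
    have h0 : thetaOdd τ V ≠ 0 := fun h0 => hη (by rw [← h, h0, mul_zero])
    rw [← h, mul_div_cancel_right₀ _ h0]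
  have e1 := recipSeries_mul_thetaP_eq hm p hτ hW hW1
  have e2 := recipSeries_mul_thetaP_eq hm p hτ (inv_ne_zero hW) hW'
  rw [← key W hW hW1] at e1
  rw [← key _ (inv_ne_zero hW) hW', thetaOdd_inv] at e2
  have e3 : ∑ k ∈ Finset.Ioc (-m : ℤ) m, coneSum m p τ k (rowCut k) 0 * thetaSym m k τ W =
      ∑ k ∈ Finset.Ioc (-m : ℤ) m, coneSum m p τ k (rowCut k) 0 * thetaInt m k τ W +
      ∑ k ∈ Finset.Ioc (-m : ℤ) m, coneSum m p τ k (rowCut k) 0 * thetaInt m k τ W⁻¹ := by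
    rw [← Finset.sum_add_distrib]
    refine Finset.sum_congr rfl fun k _ => ?_
    rw [thetaSym, thetaInt_inv]
    ring
  rw [e3]
  linear_combination e1 + e2

theorem sum_Icc_zero_natCast {m : ℕ} (hm : 1 ≤ m) (f : ℤ → ℂ) :
    ∑ k ∈ Finset.Icc (0 : ℤ) m, f k = f 0 + ∑ k ∈ Finset.Ioo (0 : ℤ) m, f k + f m := by
  have h1 : Finset.Icc (0 : ℤ) m = insert 0 (insert (m : ℤ) (Finset.Ioo (0 : ℤ) m)) := by
    ext k; simp only [Finset.mem_Icc, Finset.mem_Ioo, Finset.mem_insert]; omega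
  rw [h1, Finset.sum_insert, Finset.sum_insert (by simp)]
  · ring
  · simp only [Finset.mem_Ioo, Finset.mem_insert]; omega

theorem sum_Ico_zero_natCast {m : ℕ} (hm : 1 ≤ m) (f : ℤ → ℂ) :
    ∑ k ∈ Finset.Ico (0 : ℤ) m, f k = f 0 + ∑ k ∈ Finset.Ioo (0 : ℤ) m, f k := by
  have h1 : Finset.Ico (0 : ℤ) m = insert 0 (Finset.Ioo (0 : ℤ) m) := by
    ext k; simp only [Finset.mem_Ico, Finset.mem_Ioo, Finset.mem_insert]; omega
  rw [h1, Finset.sum_insert (by simp)]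

theorem sum_Ioc_neg_natCast {m : ℕ} (hm : 1 ≤ m) (f : ℤ → ℂ) :
    ∑ k ∈ Finset.Ioc (-m : ℤ) m, f k =
      ∑ k ∈ Finset.Icc (0 : ℤ) m, f k + ∑ k ∈ Finset.Ioo (0 : ℤ) m, f (-k) := by
  have h1 : Finset.Ioc (-m : ℤ) m = Finset.Icc (0 : ℤ) m ∪ Finset.Ioo (-m : ℤ) 0 := by
    ext k; simp only [Finset.mem_Ioc, Finset.mem_Icc, Finset.mem_Ioo, Finset.mem_union]; omega
  have h2 : ∑ k ∈ Finset.Ioo (-m : ℤ) 0, f k = ∑ k ∈ Finset.Ioo (0 : ℤ) m, f (-k) := by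
    refine Finset.sum_nbij' (fun k => -k) (fun k => -k) ?_ ?_ ?_ ?_ ?_
    · intro k hk; simp only [Finset.mem_Ioo] at hk ⊢; omega
    · intro k hk; simp only [Finset.mem_Ioo] at hk ⊢; omega
    · intro k _; ring
    · intro k _; ring
    · intro k _; rw [neg_neg]
  rw [h1, Finset.sum_union, h2]
  rw [Finset.disjoint_left]
  intro k hk
  simp only [Finset.mem_Icc, Finset.mem_Ioo] at hk ⊢
  omega

theorem sum_Ioc_neg_eq_range (p : ℕ) (f : ℤ → ℂ) :
    ∑ r ∈ Finset.Ioc (-p : ℤ) p, f r = ∑ r ∈ Finset.range p, (f (r + 1) + f (-r)) := by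
  induction p with
  | zero => simp
  | succ p ih =>
    have h1 : Finset.Ioc (-(p + 1 : ℕ) : ℤ) (p + 1 : ℕ) =
        insert ((p : ℤ) + 1) (insert (-p : ℤ) (Finset.Ioc (-p : ℤ) p)) := by
      ext k; simp only [Finset.mem_Ioc, Finset.mem_insert]; omega
    rw [h1, Finset.sum_insert, Finset.sum_insert (by simp), ih, Finset.sum_range_succ]
    · ring
    · simp only [Finset.mem_Ioc, Finset.mem_insert]; omega

theorem sum_Ico_eq_range (p : ℕ) (f : ℤ → ℂ) :
    ∑ r ∈ Finset.Ico (0 : ℤ) p, f r = ∑ r ∈ Finset.range p, f r := by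
  induction p with
  | zero => simp
  | succ p ih =>
    have h1 : Finset.Ico (0 : ℤ) (p + 1 : ℕ) = insert (p : ℤ) (Finset.Ico (0 : ℤ) p) := by
      ext k; simp only [Finset.mem_Ico, Finset.mem_insert]; omega
    rw [h1, Finset.sum_insert (by simp), ih, Finset.sum_range_succ, add_comm]

theorem sum_Ioo_neg_eq_range (p : ℕ) {f : ℤ → ℂ} (hf : ∀ r, f (-r) = f r) :
    ∑ r ∈ Finset.Ioo (-(p + 1 : ℕ) : ℤ) (p + 1 : ℕ), f r =
      2 * ∑ r ∈ Finset.range (p + 1), f r - f 0 := by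
  induction p with
  | zero =>
    have h1 : Finset.Ioo (-(0 + 1 : ℕ) : ℤ) (0 + 1 : ℕ) = {0} := by
      ext k; simp only [Finset.mem_Ioo, Finset.mem_singleton]; omega
    rw [h1]; simp; ring
  | succ p ih =>
    have h1 : Finset.Ioo (-(p + 1 + 1 : ℕ) : ℤ) (p + 1 + 1 : ℕ) = insert ((p + 1 : ℕ) : ℤ)
        (insert (-(p + 1 : ℕ) : ℤ) (Finset.Ioo (-(p + 1 : ℕ) : ℤ) (p + 1 : ℕ))) := by
      ext k; simp only [Finset.mem_Ioo, Finset.mem_insert]; omega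
    rw [h1, Finset.sum_insert, Finset.sum_insert (by simp), ih, Finset.sum_range_succ _ (p + 1), hf]
    · ring
    · simp only [Finset.mem_Ioo, Finset.mem_insert]; omega

/-- J ↦ 1-J preserves (J-½)² and reverses the sign. -/
theorem tsum_shiftCoeff_zero (m : ℕ) (τ : ℂ) : ∑' J, shiftCoeff m 0 τ J = 0 := by
  refine self_eq_neg.mp ?_
  conv_lhs => rw [← (Equiv.subLeft (1 : ℤ)).tsum_eq]
  rw [← tsum_neg]
  refine tsum_congr fun J => ?_
  rw [Equiv.subLeft_apply, shiftCoeff, shiftCoeff,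
    neg_one_zpow_congr (a := 1 - J) (b := J + 1) ⟨-J, by ring⟩, zpow_add_one₀ (by norm_num)]
  rw [mul_neg_one, neg_mul]
  congr 3
  push_cast
  ring

/-- A carries +k where B carries -k in the exponent, hence the index -k. -/
theorem termA_eq {m : ℕ} (hm : 1 ≤ m) (p : ℕ) (τ z : ℂ) {c W : ℂ} (hc : c ^ 2 = 1)
    (hW : W = c * Complex.exp (Real.pi * Complex.I * z)) (x : ℤ × ℤ) :
    termA c m p τ z x =
      ∑ k ∈ Finset.Ioo (0 : ℤ) m, regionTerm m p τ (-k) x * thetaSym m k τ W := by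
  refine Finset.sum_congr rfl fun k _ => ?_
  rw [← zpow_mul_theta_add hm k τ z hc hW, regionTerm]
  push_cast
  rw [sub_neg_eq_add]
  ring

theorem termB_eq {m : ℕ} (hm : 1 ≤ m) (p : ℕ) (τ z : ℂ) {c W : ℂ} (hc : c ^ 2 = 1)
    (hW : W = c * Complex.exp (Real.pi * Complex.I * z)) (x : ℤ × ℤ) :
    termB c m p τ z x =
      ∑ k ∈ Finset.Icc (0 : ℤ) m, regionTerm m p τ k x * thetaSym m k τ W := by
  refine Finset.sum_congr rfl fun k _ => ?_
  rw [← zpow_mul_theta_add hm k τ z hc hW, regionTerm]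
  ring

theorem summable_sum_mul {ι κ : Type*} {s : Finset κ} {S : Set ι} {f : κ → ι → ℂ} (t : κ → ℂ)
    (hf : ∀ k, Summable (S.indicator (f k))) : Summable fun x : S => ∑ k ∈ s, f k x * t k :=
  summable_sum fun k _ => (summable_subtype_iff_indicator.mpr (hf k)).mul_right _

theorem tsum_sum_mul {ι κ : Type*} {s : Finset κ} {S : Set ι} {f : κ → ι → ℂ} (t : κ → ℂ)
    (hf : ∀ k, Summable (S.indicator (f k))) :
    ∑' x : S, ∑ k ∈ s, f k x * t k = ∑ k ∈ s, (∑' x : S, f k x) * t k := by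
  have h : ∀ k ∈ s, Summable fun x : S => f k x * t k := fun k _ =>
    (summable_subtype_iff_indicator.mpr (hf k)).mul_right _
  rw [Summable.tsum_finsetSum h]
  exact Finset.sum_congr rfl fun k _ => tsum_mul_right

theorem tsum_termA {m : ℕ} (hm : 1 ≤ m) (p : ℕ) {τ : ℂ} (hτ : 0 < τ.im) (z : ℂ) {c W : ℂ}
    (hc : c ^ 2 = 1) (hW : W = c * Complex.exp (Real.pi * Complex.I * z)) :
    (∑' x : conePosLt, termA c m p τ z x) - ∑' x : coneNegLe, termA c m p τ z x =
      ∑ k ∈ Finset.Ioo (0 : ℤ) m, (-1) ^ p * coneSum m p τ (-k) p 0 * thetaSym m k τ W := by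
  simp_rw [termA_eq hm p τ z hc hW]
  rw [tsum_sum_mul _ fun k => summable_conePosLt hm p hτ (-k),
    tsum_sum_mul _ fun k => summable_coneNegLe hm p hτ (-k), ← Finset.sum_sub_distrib]
  refine Finset.sum_congr rfl fun k _ => ?_
  rw [← sub_mul, tsum_coneA hm p hτ]

theorem tsum_termB {m : ℕ} (hm : 1 ≤ m) (p : ℕ) {τ : ℂ} (hτ : 0 < τ.im) (z : ℂ) {c W : ℂ}
    (hc : c ^ 2 = 1) (hW : W = c * Complex.exp (Real.pi * Complex.I * z)) :
    (∑' x : conePosLe, termB c m p τ z x) - ∑' x : coneNegLt, termB c m p τ z x =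
      ∑ k ∈ Finset.Icc (0 : ℤ) m, (-1) ^ p * coneSum m p τ k p 1 * thetaSym m k τ W := by
  simp_rw [termB_eq hm p τ z hc hW]
  rw [tsum_sum_mul _ fun k => summable_conePosLe hm p hτ k,
    tsum_sum_mul _ fun k => summable_coneNegLt hm p hτ k, ← Finset.sum_sub_distrib]
  refine Finset.sum_congr rfl fun k _ => ?_
  rw [← sub_mul, tsum_coneB hm p hτ]

/-- The finite part of the comparison of the two sides. -/
theorem sum_coneSum_eq {m : ℕ} (hm : 1 ≤ m) (p : ℕ) {τ : ℂ} (hτ : 0 < τ.im) {t : ℤ → ℂ}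
    (ht : ∀ k, t (-k) = t k) :
    ∑ k ∈ Finset.Ioc (-m : ℤ) m, coneSum m p τ k (rowCut k) 0 * t k =
      ∑ k ∈ Finset.Icc (0 : ℤ) m, coneSum m p τ k p 1 * t k +
      ∑ k ∈ Finset.Ioo (0 : ℤ) m, coneSum m p τ (-k) p 0 * t k +
      (∑' J, shiftCoeff m p τ J) *
        (∑ k ∈ Finset.Icc (0 : ℤ) m,
          ((∑ r ∈ Finset.range p, rowCoeff m τ k r) - rowCoeff m τ k 0) * t k +
        ∑ k ∈ Finset.Ioo (0 : ℤ) m, (∑ r ∈ Finset.range p, rowCoeff m τ (-k) r) * t k) := by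
  have h1 : ∑ k ∈ Finset.Icc (0 : ℤ) m, coneSum m p τ k (rowCut k) 0 * t k =
      ∑ k ∈ Finset.Icc (0 : ℤ) m, (coneSum m p τ k p 1 * t k + (∑' J, shiftCoeff m p τ J) *
        (((∑ r ∈ Finset.range p, rowCoeff m τ k r) - rowCoeff m τ k 0) * t k)) := by
    refine Finset.sum_congr rfl fun k hk => ?_
    rw [Finset.mem_Icc] at hk
    -- For k ≥ 0 the row cut starts at 1, not 0; this extra row is the term that Φ_add has to
    -- absorb.
    have e1 := coneSum_row_nat hm p hτ k 1 0
    rw [rowCut, if_pos hk.1, coneSum_diag hm p hτ k p 1, coneSum_row_nat hm p hτ k p 0]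
    rw [Finset.sum_range_one, Nat.cast_one, Nat.cast_zero] at e1
    rw [e1]
    ring
  have h2 : ∑ k ∈ Finset.Ioo (0 : ℤ) m, coneSum m p τ (-k) (rowCut (-k)) 0 * t (-k) =
      ∑ k ∈ Finset.Ioo (0 : ℤ) m, (coneSum m p τ (-k) p 0 * t k + (∑' J, shiftCoeff m p τ J) *
        ((∑ r ∈ Finset.range p, rowCoeff m τ (-k) r) * t k)) := by
    refine Finset.sum_congr rfl fun k hk => ?_
    rw [Finset.mem_Ioo] at hk
    rw [rowCut, if_neg (by omega), coneSum_row_nat hm p hτ (-k) p 0, ht]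
    ring
  rw [sum_Ioc_neg_natCast hm, h1, h2, Finset.sum_add_distrib, Finset.sum_add_distrib,
    ← Finset.mul_sum, ← Finset.mul_sum]
  ring

theorem qpow_row_sum {m : ℕ} (p : ℕ) (τ : ℂ) (k : ℤ) :
    ∑ r ∈ Finset.Ioc (-(p : ℤ)) p, qpow τ (-((m : ℚ) * (2 * r - 1) + k) ^ 2 / (4 * m)) =
      (∑ r ∈ Finset.range p, rowCoeff m τ k r) + ∑ r ∈ Finset.range p, rowCoeff m τ (-k) r := by
  rw [sum_Ioc_neg_eq_range, ← Finset.sum_add_distrib]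
  refine Finset.sum_congr rfl fun r _ => ?_
  rw [rowCoeff, rowCoeff, add_comm]
  congr 2
  · push_cast; ring
  · push_cast; ring

theorem rowCoeff_self {m : ℕ} (hm : 1 ≤ m) (τ : ℂ) (r : ℤ) :
    rowCoeff m τ m r = qpow τ (-(m : ℚ) * (r : ℚ) ^ 2) := by
  have hm0 : (m : ℚ) ≠ 0 := by positivity
  rw [rowCoeff]
  congr 1
  push_cast
  field_simp
  ring

theorem rowCoeff_zero_left {m : ℕ} (hm : 1 ≤ m) (τ : ℂ) (r : ℤ) :
    rowCoeff m τ 0 r = qpow τ (-(m : ℚ) * ((r : ℚ) + 1 / 2) ^ 2) := by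
  have hm0 : (m : ℚ) ≠ 0 := by positivity
  rw [rowCoeff]
  congr 1
  push_cast
  field_simp
  ring

/-- For p ≥ 1 this is the symmetry r ↔ -r, with r = 0 counted once. For p = 0 the left sum is empty
while the right bracket is -1, and the vanishing of the theta constant saves the identity. -/
theorem tsum_shiftCoeff_mul_sum_Ioo {m : ℕ} (hm : 1 ≤ m) (p : ℕ) (τ : ℂ) :
    (∑' J, shiftCoeff m p τ J) * ∑ r ∈ Finset.Ioo (-(p : ℤ)) p, qpow τ (-(m : ℚ) * (r : ℚ) ^ 2) =
      (∑' J, shiftCoeff m p τ J) * (2 * (∑ r ∈ Finset.range p, rowCoeff m τ m r) - 1) := by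
  cases p with
  | zero => rw [tsum_shiftCoeff_zero, zero_mul, zero_mul]
  | succ p =>
    rw [sum_Ioo_neg_eq_range p (f := fun r => qpow τ (-(m : ℚ) * (r : ℚ) ^ 2))
      (fun r => by push_cast; rw [neg_sq])]
    simp_rw [rowCoeff_self hm]
    simp [qpow_zero]

/-! ### The main identity -/

/-- Both parts of the proposition at once, in terms of the sign `c` and of `W = c e^{πiz}`. -/
theorem main_identity {m : ℕ} (hm : 1 ≤ m) (p : ℕ) {τ : ℂ} (hτ : 0 < τ.im) {z z₁ z₂ c W : ℂ}
    (hc : c ^ 2 = 1) (hW : W = c * Complex.exp (Real.pi * Complex.I * z)) (h1 : z₁ + z₂ = z)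
    (him : ((z₁ - z₂) / 2).im = τ.im / 2)
    (hexp : Complex.exp (2 * Real.pi * Complex.I * ((z₁ - z₂) / 2)) = c * qpow τ (1 / 2))
    (hz₁ : Complex.exp (2 * Real.pi * Complex.I * z₁) = W * qpow τ (1 / 2))
    (hz₂ : Complex.exp (-2 * Real.pi * Complex.I * z₂) = W⁻¹ * qpow τ (1 / 2))
    (hW1 : ∀ n : ℤ, 1 - W * qpow τ (n + 1 / 2) ≠ 0) {D : ℂ}
    (hD : D = (-1) ^ p * ∑' J, shiftCoeff m p τ J) :
    D * qpow τ (-(m : ℚ) / 4) * PhiStarTilde m 0 τ z₁ z₂ 0 =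
      (-1) ^ p * (ModularForm.eta τ ^ 3 / thetaOdd τ W * (thetaP m p τ W + thetaP m p τ W⁻¹))
        - ((∑' x : conePosLt, termA c m p τ z x) - ∑' x : coneNegLe, termA c m p τ z x)
        - ((∑' x : conePosLe, termB c m p τ z x) - ∑' x : coneNegLt, termB c m p τ z x)
        - D * ∑ r ∈ Finset.Ioc (-(p : ℤ)) p, ∑ k ∈ Finset.Ico (0 : ℤ) m,
            c ^ k * qpow τ (-((m : ℚ) * (2 * r - 1) + k) ^ 2 / (4 * m))
              * (theta (k : ℚ) m τ z + theta (-(k : ℚ)) m τ z)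
        + 2 * D * ∑ r ∈ Finset.Ico (0 : ℤ) p,
            qpow τ (-(m : ℚ) * ((r : ℚ) + 1 / 2) ^ 2) * theta 0 m τ z
        - c ^ m * D * ∑ r ∈ Finset.Ioo (-(p : ℤ)) p,
            qpow τ (-(m : ℚ) * (r : ℚ) ^ 2) * theta m m τ z := by
  have hc0 : c ≠ 0 := by rintro rfl; simp at hc
  have hW0 : W ≠ 0 := by rw [hW]; exact mul_ne_zero hc0 (Complex.exp_ne_zero _)
  set t : ℤ → ℂ := fun k => thetaSym m k τ W with ht
  have e1 : qpow τ (-(m : ℚ) / 4) * qpow τ ((m : ℚ) / 4) = 1 := by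
    rw [← qpow_add, ← qpow_zero τ]; congr 1; ring
  have e2 : ∑ r ∈ Finset.Ioc (-(p : ℤ)) p, ∑ k ∈ Finset.Ico (0 : ℤ) m,
      c ^ k * qpow τ (-((m : ℚ) * (2 * r - 1) + k) ^ 2 / (4 * m))
        * (theta (k : ℚ) m τ z + theta (-(k : ℚ)) m τ z) =
      ∑ k ∈ Finset.Ico (0 : ℤ) m, ((∑ r ∈ Finset.range p, rowCoeff m τ k r) +
        ∑ r ∈ Finset.range p, rowCoeff m τ (-k) r) * t k := by
    rw [Finset.sum_comm]
    refine Finset.sum_congr rfl fun k _ => ?_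
    rw [← qpow_row_sum, Finset.sum_mul]
    refine Finset.sum_congr rfl fun r _ => ?_
    rw [ht]
    simp only
    rw [← zpow_mul_theta_add hm k τ z hc hW]
    ring
  -- In `e2` the index k = 0 is counted both as k and as -k; this sum compensates one copy.
  have e3 : 2 * ∑ r ∈ Finset.Ico (0 : ℤ) p,
      qpow τ (-(m : ℚ) * ((r : ℚ) + 1 / 2) ^ 2) * theta 0 m τ z =
      (∑ r ∈ Finset.range p, rowCoeff m τ 0 r) * t 0 := by
    have h := zpow_mul_theta_add hm 0 τ z hc hW
    rw [zpow_zero, one_mul, Int.cast_zero, neg_zero, ← two_mul] at h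
    rw [← Finset.sum_mul, sum_Ico_eq_range p fun r => qpow τ (-(m : ℚ) * ((r : ℚ) + 1 / 2) ^ 2)]
    simp_rw [rowCoeff_zero_left hm]
    rw [ht]
    simp only
    rw [← h]
    ring
  -- θ_{m,m} = θ_{-m,m}, so the symmetrised function is twice θ_{m,m}. This ½ accounts for the half
  -- row left over at k = m.
  have e4 : c ^ m * theta m m τ z = 1 / 2 * t m := by
    have h := zpow_mul_theta hm m τ z hc hW
    have h' := thetaInt_add_two_mul hm (-m) τ W
    rw [show -(m : ℤ) + 2 * m = m by ring] at h'
    rw [zpow_natCast, Int.cast_natCast] at h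
    rw [h, ht]
    simp only
    rw [thetaSym, ← h']
    ring
  have e5 := eta_div_thetaOdd_mul hm p hτ hW0 hW1
  rw [sum_coneSum_eq hm p hτ (t := t) fun k => thetaSym_neg m k τ W] at e5
  have e6 := tsum_shiftCoeff_mul_sum_Ioo hm p τ
  have e7 : rowCoeff m τ m 0 = 1 := by rw [rowCoeff_self hm]; simp [qpow_zero]
  have e8 : c ^ m * D * ∑ r ∈ Finset.Ioo (-(p : ℤ)) p,
      qpow τ (-(m : ℚ) * (r : ℚ) ^ 2) * theta m m τ z =
      D * ((∑ r ∈ Finset.range p, rowCoeff m τ m r) - 1 / 2) * t m := by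
    rw [← Finset.sum_mul, hD]
    linear_combination (-1) ^ p * (c ^ m * theta m m τ z) * e6 + (-1) ^ p *
      (∑' J, shiftCoeff m p τ J) * (2 * (∑ r ∈ Finset.range p, rowCoeff m τ m r) - 1) * e4
  have hW2 : W ^ 2 = Complex.exp (2 * Real.pi * Complex.I * z) := by
    rw [hW, mul_pow, hc, one_mul, ← Complex.exp_nat_mul]; congr 1; push_cast; ring
  rw [PhiStarTilde, PhiStar_eq hW2 h1 hz₁ hz₂, PhiStarAdd_eq hm hτ hc hW h1 him hexp,
    tsum_termA hm p hτ z hc hW, tsum_termB hm p hτ z hc hW, e2, e5, e8, mul_comm 2 D,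
    mul_assoc D 2, e3, sum_Ico_zero_natCast hm]
  simp only [mul_assoc ((-1 : ℂ) ^ p)]
  rw [← Finset.mul_sum, ← Finset.mul_sum]
  simp only [sub_mul, add_mul, Finset.sum_add_distrib, Finset.sum_sub_distrib]
  rw [sum_Icc_zero_natCast hm fun k => (∑ r ∈ Finset.range p, rowCoeff m τ k r) * t k,
    sum_Icc_zero_natCast hm fun k => rowCoeff m τ k 0 * t k, neg_zero, e7, hD]
  simp only [ht]
  -- Only the prefactors q^{-m/4} and q^{m/4} of Φ_add remain to be cancelled.
  linear_combination (-(-1) ^ p * (∑' J, shiftCoeff m p τ J) * (rowCoeff m τ 0 0 * thetaSym m 0 τ W +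
        ∑ j ∈ Finset.Ioo (0 : ℤ) m, rowCoeff m τ j 0 * thetaSym m j τ W +
        1 / 2 * thetaSym m m τ W)) * e1

/-! ### Translation to the notation of the statement -/

/-- A zero would mean z₁ + nτ ∈ ℤ, which is excluded. -/
theorem one_sub_mul_qpow_ne_zero {τ z₁ W : ℂ}
    (hz₁ : Complex.exp (2 * Real.pi * Complex.I * z₁) = W * qpow τ (1 / 2))
    (h : ∀ a b : ℤ, z₁ ≠ a + b * τ) (n : ℤ) : 1 - W * qpow τ (n + 1 / 2) ≠ 0 := by
  intro h0
  have h1 : Complex.exp (2 * Real.pi * Complex.I * (z₁ + n * τ)) = 1 := by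
    have h2 : Complex.exp (2 * Real.pi * Complex.I * (n * τ)) = qpow τ n := by
      rw [qpow]; congr 1; push_cast; ring
    rw [mul_add, Complex.exp_add, hz₁, h2, mul_assoc, ← qpow_add, add_comm, ← sub_eq_zero,
      ← neg_eq_zero, neg_sub, h0]
  obtain ⟨a, ha⟩ := Complex.exp_eq_one_iff.mp h1
  apply h a (-n)
  have hpi : 2 * (Real.pi : ℂ) * Complex.I ≠ 0 := Complex.two_pi_I_ne_zero
  have h2 : z₁ + n * τ = a := mul_left_cancel₀ hpi (by rw [ha]; ring)
  push_cast
  linear_combination h2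

theorem thetaMinus_zero_half (τ z : ℂ) :
    thetaMinus 0 (1 / 2) τ z = thetaOdd τ (Complex.exp (Real.pi * Complex.I * z)) := by
  refine tsum_congr fun j => ?_
  rw [exp_pi_mul_zpow]
  congr 2
  · congr 1; ring
  · congr 1; push_cast; ring

theorem theta_zero_half (τ z : ℂ) :
    theta 0 (1 / 2) τ z = thetaOdd τ (-Complex.exp (Real.pi * Complex.I * z)) := by
  refine tsum_congr fun j => ?_
  have h2 : (-1 : ℂ) ^ j * (-1) ^ j = 1 := by rw [← mul_zpow]; norm_num
  have e1 : qpow τ (1 / 2 * ((j : ℚ) + 0 / (2 * (1 / 2))) ^ 2) = qpow τ ((j : ℚ) ^ 2 / 2) := by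
    congr 1; ring
  have e2 : Complex.exp (2 * Real.pi * Complex.I *
      (((1 / 2 * ((j : ℚ) + 0 / (2 * (1 / 2))) : ℚ)) : ℂ) * z) =
      Complex.exp (Real.pi * Complex.I * z) ^ j := by
    rw [exp_pi_mul_zpow]; congr 1; push_cast; ring
  rw [neg_eq_neg_one_mul (Complex.exp _), mul_zpow, e1, e2]
  linear_combination -(qpow τ ((j : ℚ) ^ 2 / 2) * Complex.exp (Real.pi * Complex.I * z) ^ j) * h2

theorem exp_index (m p : ℕ) (j : ℤ) (z : ℂ) :
    Complex.exp (2 * Real.pi * Complex.I *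
      ((((m : ℚ) + 1 / 2) * ((j : ℚ) + p / (2 * ((m : ℚ) + 1 / 2))) : ℚ) : ℂ) * z) =
      Complex.exp (Real.pi * Complex.I * z) ^ ((2 * m + 1) * j + p) := by
  have hm : (2 * (m : ℂ) + 1) ≠ 0 := by exact_mod_cast (by positivity : (2 * (m : ℚ) + 1) ≠ 0)
  rw [exp_pi_mul_zpow]
  congr 1
  push_cast
  rw [show (2 : ℂ) * (m + 1 / 2) = 2 * m + 1 by ring]
  field_simp

theorem qpow_index (m p : ℕ) (j : ℤ) (τ : ℂ) :
    qpow τ (((m : ℚ) + 1 / 2) * ((j : ℚ) + p / (2 * ((m : ℚ) + 1 / 2))) ^ 2) =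
      qpow τ (((m : ℚ) + 1 / 2) * (j + p / (2 * m + 1)) ^ 2) := by
  rw [show (2 : ℚ) * (m + 1 / 2) = 2 * m + 1 by ring]

theorem thetaMinus_natCast (m p : ℕ) (τ z : ℂ) : thetaMinus (p : ℚ) ((m : ℚ) + 1 / 2) τ z =
    thetaP m p τ (Complex.exp (Real.pi * Complex.I * z)) := by
  refine tsum_congr fun j => ?_
  rw [exp_index, qpow_index]

/-- (2m+1)j+p ≡ j+p modulo 2, so negating W cancels the alternating sign of `thetaP` up to (-1)^p.
-/
theorem theta_natCast (m p : ℕ) (τ z : ℂ) : theta (p : ℚ) ((m : ℚ) + 1 / 2) τ z =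
    (-1) ^ p * thetaP m p τ (-Complex.exp (Real.pi * Complex.I * z)) := by
  rw [thetaP, ← tsum_mul_left]
  refine tsum_congr fun j => ?_
  have h1 : (-1 : ℂ) ^ p * (-1) ^ p = 1 := by rw [← mul_pow]; norm_num
  have h2 : (-1 : ℂ) ^ j * (-1) ^ j = 1 := by rw [← mul_zpow]; norm_num
  have h3 : (-1 : ℂ) ^ ((2 * m + 1) * j + p) = (-1) ^ p * (-1) ^ j := by
    rw [neg_one_zpow_congr (a := (2 * m + 1) * j + p) (b := p + j) ⟨m * j, by ring⟩,
      zpow_add₀ (by norm_num), zpow_natCast]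
  rw [exp_index, qpow_index, neg_eq_neg_one_mul (Complex.exp _), mul_zpow, h3]
  generalize qpow τ _ = a
  generalize Complex.exp (Real.pi * Complex.I * z) ^ ((2 * m + 1) * j + (p : ℤ)) = b
  linear_combination -(a * b * ((-1) ^ j * (-1) ^ j)) * h1 - (a * b) * h2

theorem theta_neg_left (k M : ℚ) (τ z : ℂ) : theta (-k) M τ z = theta k M τ (-z) := by
  rw [theta, theta, ← (Equiv.neg ℤ).tsum_eq]
  refine tsum_congr fun j => ?_
  rw [Equiv.neg_apply]
  congr 2
  · push_cast; ring
  · push_cast; ring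

theorem thetaMinus_neg_left (k M : ℚ) (τ z : ℂ) : thetaMinus (-k) M τ z = thetaMinus k M τ (-z) := by
  rw [thetaMinus, thetaMinus, ← (Equiv.neg ℤ).tsum_eq]
  refine tsum_congr fun j => ?_
  rw [Equiv.neg_apply, neg_one_zpow_congr (a := -j) (b := j) ⟨-j, by ring⟩]
  congr 2
  · congr 2; push_cast; ring
  · push_cast; ring

theorem exp_pi_neg (z : ℂ) : Complex.exp (Real.pi * Complex.I * -z) =
    (Complex.exp (Real.pi * Complex.I * z))⁻¹ := by
  rw [mul_neg, Complex.exp_neg]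

theorem thetaMinus_add_neg (m p : ℕ) (τ z : ℂ) :
    thetaMinus (p : ℚ) ((m : ℚ) + 1 / 2) τ z + thetaMinus (-(p : ℚ)) ((m : ℚ) + 1 / 2) τ z =
      thetaP m p τ (Complex.exp (Real.pi * Complex.I * z)) +
        thetaP m p τ (Complex.exp (Real.pi * Complex.I * z))⁻¹ := by
  rw [thetaMinus_neg_left, thetaMinus_natCast, thetaMinus_natCast, exp_pi_neg]

theorem theta_add_neg (m p : ℕ) (τ z : ℂ) :
    theta (p : ℚ) ((m : ℚ) + 1 / 2) τ z + theta (-(p : ℚ)) ((m : ℚ) + 1 / 2) τ z =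
      (-1) ^ p * (thetaP m p τ (-Complex.exp (Real.pi * Complex.I * z)) +
        thetaP m p τ (-Complex.exp (Real.pi * Complex.I * z))⁻¹) := by
  rw [theta_neg_left, theta_natCast, theta_natCast, exp_pi_neg, inv_neg, mul_add]

theorem thetaMinus_shift (m p : ℕ) (τ : ℂ) :
    thetaMinus ((p : ℚ) - m - 1 / 2) ((m : ℚ) + 1 / 2) τ 0 = ∑' J, shiftCoeff m p τ J := by
  refine tsum_congr fun j => ?_
  have hm : (2 * (m : ℚ) + 1) ≠ 0 := by positivity
  rw [mul_zero, Complex.exp_zero, mul_one, shiftCoeff, show (2 : ℚ) * (m + 1 / 2) = 2 * m + 1 by ring]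
  congr 2
  field_simp
  ring

theorem thetaMinus_shift_neg (m p : ℕ) (τ : ℂ) :
    thetaMinus (-(p : ℚ) + m + 1 / 2) ((m : ℚ) + 1 / 2) τ 0 = ∑' J, shiftCoeff m p τ J := by
  rw [← thetaMinus_shift, show -(p : ℚ) + m + 1 / 2 = -((p : ℚ) - m - 1 / 2) by ring,
    thetaMinus_neg_left, neg_zero]

/-- The substitution j = -p-J negates the base of the square; the parity of j supplies (-1)^p. -/
theorem thetaMinus_shift_mul (m p : ℕ) (τ : ℂ) :
    thetaMinus (2 * m * p + m + 1 / 2) ((m : ℚ) + 1 / 2) τ 0 =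
      (-1) ^ p * ∑' J, shiftCoeff m p τ J := by
  have hm : (2 * (m : ℚ) + 1) ≠ 0 := by positivity
  rw [thetaMinus, ← tsum_mul_left, ← (Equiv.subLeft (-(p : ℤ))).tsum_eq]
  refine tsum_congr fun j => ?_
  rw [mul_zero, Complex.exp_zero, mul_one, shiftCoeff, Equiv.subLeft_apply,
    show (2 : ℚ) * (m + 1 / 2) = 2 * m + 1 by ring,
    neg_one_zpow_congr (a := -(p : ℤ) - j) (b := p + j) ⟨-p - j, by ring⟩,
    zpow_add₀ (by norm_num), zpow_natCast, mul_assoc]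
  congr 3
  push_cast
  field_simp
  ring

theorem exp_pi_mul_tau (τ : ℂ) : Complex.exp (Real.pi * Complex.I * τ) = qpow τ (1 / 2) := by
  rw [qpow]; congr 1; push_cast; ring

end Wakimoto

open Wakimoto in
theorem propositionm1 (m : ℕ) (hm : 1 ≤ m) (p : ℕ) (τ : ℂ) (hτ : 0 < τ.im) (z : ℂ) :
    -- absolute convergence of the indefinite double series, for both signs `c = -1, 1`
    (∀ c : ℂ, c = -1 ∨ c = 1 →
      Summable (fun x : conePosLt => termA c m p τ z x) ∧
      Summable (fun x : coneNegLe => termA c m p τ z x) ∧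
      Summable (fun x : conePosLe => termB c m p τ z x) ∧
      Summable (fun x : coneNegLt => termB c m p τ z x)) ∧
    -- part 1
    ((∀ a b : ℤ, z / 2 + τ / 2 - 1 / 2 ≠ a + b * τ) →
      (-1 : ℂ) ^ p * qpow τ (-(m : ℚ) / 4)
          * thetaMinus ((p : ℚ) - m - 1 / 2) ((m : ℚ) + 1 / 2) τ 0
          * PhiStarTilde m 0 τ (z / 2 + τ / 2 - 1 / 2) (z / 2 - τ / 2 + 1 / 2) 0
        = ModularForm.eta τ ^ 3 / theta 0 (1 / 2) τ z
            * (theta (p : ℚ) ((m : ℚ) + 1 / 2) τ z + theta (-(p : ℚ)) ((m : ℚ) + 1 / 2) τ z)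
          - ((∑' x : conePosLt, termA (-1) m p τ z x) - ∑' x : coneNegLe, termA (-1) m p τ z x)
          - ((∑' x : conePosLe, termB (-1) m p τ z x) - ∑' x : coneNegLt, termB (-1) m p τ z x)
          - (-1 : ℂ) ^ p * thetaMinus ((p : ℚ) - m - 1 / 2) ((m : ℚ) + 1 / 2) τ 0
            * ∑ r ∈ Finset.Ioc (-(p : ℤ)) p, ∑ k ∈ Finset.Ico (0 : ℤ) m,
                (-1 : ℂ) ^ k * qpow τ (-((m : ℚ) * (2 * r - 1) + k) ^ 2 / (4 * m))
                  * (theta (k : ℚ) m τ z + theta (-(k : ℚ)) m τ z)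
          + 2 * (-1 : ℂ) ^ p * thetaMinus ((p : ℚ) - m - 1 / 2) ((m : ℚ) + 1 / 2) τ 0
            * ∑ r ∈ Finset.Ico (0 : ℤ) p,
                qpow τ (-(m : ℚ) * ((r : ℚ) + 1 / 2) ^ 2) * theta 0 m τ z
          - (-1 : ℂ) ^ (m + p) * thetaMinus ((p : ℚ) - m - 1 / 2) ((m : ℚ) + 1 / 2) τ 0
            * ∑ r ∈ Finset.Ioo (-(p : ℤ)) p,
                qpow τ (-(m : ℚ) * (r : ℚ) ^ 2) * theta m m τ z) ∧
    -- part 2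
    ((∀ a b : ℤ, z / 2 + τ / 2 ≠ a + b * τ) →
      (-1 : ℂ) ^ p * qpow τ (-(m : ℚ) / 4)
          * thetaMinus (-(p : ℚ) + m + 1 / 2) ((m : ℚ) + 1 / 2) τ 0
          * PhiStarTilde m 0 τ (z / 2 + τ / 2) (z / 2 - τ / 2) 0
        = (-1 : ℂ) ^ p * (ModularForm.eta τ ^ 3 / thetaMinus 0 (1 / 2) τ z)
            * (thetaMinus (p : ℚ) ((m : ℚ) + 1 / 2) τ z
                + thetaMinus (-(p : ℚ)) ((m : ℚ) + 1 / 2) τ z)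
          - ((∑' x : conePosLt, termA 1 m p τ z x) - ∑' x : coneNegLe, termA 1 m p τ z x)
          - ((∑' x : conePosLe, termB 1 m p τ z x) - ∑' x : coneNegLt, termB 1 m p τ z x)
          - thetaMinus (2 * m * p + m + 1 / 2) ((m : ℚ) + 1 / 2) τ 0
            * ∑ r ∈ Finset.Ioc (-(p : ℤ)) p, ∑ k ∈ Finset.Ico (0 : ℤ) m,
                qpow τ (-((m : ℚ) * (2 * r - 1) + k) ^ 2 / (4 * m))
                  * (theta (k : ℚ) m τ z + theta (-(k : ℚ)) m τ z)
          + 2 * thetaMinus (2 * m * p + m + 1 / 2) ((m : ℚ) + 1 / 2) τ 0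
            * ∑ r ∈ Finset.Ico (0 : ℤ) p,
                qpow τ (-(m : ℚ) * ((r : ℚ) + 1 / 2) ^ 2) * theta 0 m τ z
          - thetaMinus (2 * m * p + m + 1 / 2) ((m : ℚ) + 1 / 2) τ 0
            * ∑ r ∈ Finset.Ioo (-(p : ℤ)) p,
                qpow τ (-(m : ℚ) * (r : ℚ) ^ 2) * theta m m τ z) := by
  refine ⟨fun c hc => ?_, fun h => ?_, fun h => ?_⟩
  -- In ℂ, unconditional summability is absolute convergence.
  · have hc2 : c ^ 2 = 1 := by rcases hc with rfl | rfl <;> norm_num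
    simp_rw [termA_eq hm p τ z hc2 rfl, termB_eq hm p τ z hc2 rfl]
    exact ⟨summable_sum_mul _ fun k => summable_conePosLt hm p hτ (-k),
      summable_sum_mul _ fun k => summable_coneNegLe hm p hτ (-k),
      summable_sum_mul _ fun k => summable_conePosLe hm p hτ k,
      summable_sum_mul _ fun k => summable_coneNegLt hm p hτ k⟩
  · have hz₁ : Complex.exp (2 * Real.pi * Complex.I * (z / 2 + τ / 2 - 1 / 2)) =
        (-1 * Complex.exp (Real.pi * Complex.I * z)) * qpow τ (1 / 2) := by
      rw [← exp_pi_mul_tau, ← Complex.exp_neg_pi_mul_I, ← Complex.exp_add, ← Complex.exp_add]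
      congr 1; ring
    have hz₂ : Complex.exp (-2 * Real.pi * Complex.I * (z / 2 - τ / 2 + 1 / 2)) =
        (-1 * Complex.exp (Real.pi * Complex.I * z))⁻¹ * qpow τ (1 / 2) := by
      rw [← exp_pi_mul_tau, mul_inv, ← Complex.exp_neg, inv_neg_one, ← Complex.exp_neg_pi_mul_I,
        ← Complex.exp_add, ← Complex.exp_add]
      congr 1; ring
    have hexp : Complex.exp (2 * Real.pi * Complex.I *
        ((z / 2 + τ / 2 - 1 / 2 - (z / 2 - τ / 2 + 1 / 2)) / 2)) = -1 * qpow τ (1 / 2) := by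
      rw [← exp_pi_mul_tau, ← Complex.exp_neg_pi_mul_I, ← Complex.exp_add]
      congr 1; ring
    have him : ((z / 2 + τ / 2 - 1 / 2 - (z / 2 - τ / 2 + 1 / 2)) / 2).im = τ.im / 2 := by
      rw [show (z / 2 + τ / 2 - 1 / 2 - (z / 2 - τ / 2 + 1 / 2)) / 2 = τ / 2 - 1 / 2 by ring]
      simp
    have key := main_identity hm p hτ (c := -1) (by norm_num) rfl (by ring) him hexp hz₁ hz₂
      (one_sub_mul_qpow_ne_zero hz₁ h) rfl
    have h2 : (-1 : ℂ) ^ p * (-1) ^ p = 1 := by rw [← mul_pow]; norm_num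
    rw [thetaMinus_shift, theta_add_neg, theta_zero_half, pow_add]
    rw [neg_one_mul (Complex.exp _)] at key
    linear_combination key
  · have hz₁ : Complex.exp (2 * Real.pi * Complex.I * (z / 2 + τ / 2)) =
        (1 * Complex.exp (Real.pi * Complex.I * z)) * qpow τ (1 / 2) := by
      rw [← exp_pi_mul_tau, one_mul, ← Complex.exp_add]
      congr 1; ring
    have hz₂ : Complex.exp (-2 * Real.pi * Complex.I * (z / 2 - τ / 2)) =
        (1 * Complex.exp (Real.pi * Complex.I * z))⁻¹ * qpow τ (1 / 2) := by
      rw [← exp_pi_mul_tau, one_mul, ← Complex.exp_neg, ← Complex.exp_add]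
      congr 1; ring
    have hexp : Complex.exp (2 * Real.pi * Complex.I *
        ((z / 2 + τ / 2 - (z / 2 - τ / 2)) / 2)) = 1 * qpow τ (1 / 2) := by
      rw [← exp_pi_mul_tau, one_mul]
      congr 1; ring
    have him : ((z / 2 + τ / 2 - (z / 2 - τ / 2)) / 2).im = τ.im / 2 := by
      rw [show (z / 2 + τ / 2 - (z / 2 - τ / 2)) / 2 = τ / 2 by ring]
      simp
    have key := main_identity hm p hτ (c := 1) (by norm_num) rfl (by ring) him hexp hz₁ hz₂
      (one_sub_mul_qpow_ne_zero hz₁ h) rfl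
    rw [thetaMinus_shift_neg, thetaMinus_shift_mul, thetaMinus_add_neg, thetaMinus_zero_half]
    simp only [one_zpow, one_pow, one_mul] at key
    linear_combination key
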